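/- **Setting.** Let $-\infty\le \ell<u\le\infty$ and let $\mathsf X=\{x\in\mathbb R:\ell\le x\le u\}$ be the state space of a controlled Markov process with actions $a\in\{0,1\}$ (passive/active), Markov transition kernels $\kappa^a$ on $\mathsf X$, one-period rewards $r(x,a)$ and resource consumptions $c(x,a)$, and discount factor $\beta\in[0,1)$. Assume that for each $a$ the functions $r(\cdot,a),c(\cdot,a)$ are continuous, that $0\le c(x,0)<c(x,1)$ for all $x$, and that there are a measurable $w:\mathsf X\to[1,\infty)$ and constants $M>0$, $\gamma\in[\beta,1)$ with $\max\{|r(x,a)|,c(x,a)\}\le M\,w(x)$ and $\beta\int w\,d\kappa^a(x,\cdot)\le\gamma\,w(x)$ for all $x,a$. For a history-dependent randomized policy $\pi$ and an initial state $x$ put $$F(x,\pi)=\mathsf E_x^\pi\Big[\sum_{t\ge0}\beta^t r(X_t,A_t)\Big],\qquad G(x,\pi)=\mathsf E_x^\pi\Big[\sum_{t\ge0}\beta^t c(X_t,A_t)\Big],$$ and for $\lambda\in\mathbb R$ put $V_\lambda(x,\pi)=F(x,\pi)-\lambda G(x,\pi)$ and $V_\lambda^*(x)=\sup_\pi V_\lambda(x,\pi)$.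 A policy $\pi$ is $P_\lambda$-optimal if $V_\lambda(x,\pi)=V^*_\lambda(x)$ for every $x$. Action $a$ is $P_\lambda$-optimal in state $x$ if $\mathcal T^a_\lambda V^*_\lambda(x)\ge\mathcal T^{1-a}_\lambda V^*_\lambda(x)$, where $\mathcal T^a_\lambda v(x)=r(x,a)-\lambda c(x,a)+\beta\int v\,d\kappa^a(x,\cdot)$. The project is indexable with index $\lambda^*:\mathsf X\to\mathbb R$ if, for every $\lambda\in\mathbb R$ and $x\in\mathsf X$, action $1$ is $P_\lambda$-optimal in $x$ iff $\lambda^*(x)\ge\lambda$, and action $0$ is $P_\lambda$-optimal in $x$ iff $\lambda^*(x)\le\lambda$. For $z\in[-\infty,\infty]$ the $z$-policy is active exactly in the states $x>z$, and the $z^-$-policy exactly in the states $x\ge z$. Write $F(x,z),G(x,z)$ for the metrics of the $z$-policy. Let $\langle a,z\rangle$ be the policy that takes action $a$ at time $0$ and follows the $z$-policy from time $1$ on, and put $f(x,z)=F(x,\langle1,z\rangle)-F(x,\langle0,z\rangle)$ and $g(x,z)=G(x,\langle1,z\rangle)-G(x,\langle0,z\rangle)$. The marginal productivity (MP) index is $m^*(x)=f(x,x)/g(x,x)$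 for $x\in\mathsf X$; it is extended to $\mathbb R$ by $m^*(z)=m^*(\ell)$ for $z<\ell$ and $m^*(z)=m^*(u)$ for $z>u$. **Theorem.** Suppose that * (PCLI1) $g(x,z)>0$ for every $x\in\mathsf X$ and $z\in[-\infty,\infty]$; * (PCLI2) $m^*$ is nondecreasing, continuous and bounded below on $\mathsf X$; * (PCLI3) for every $x\in\mathsf X$ and all real $z_1<z_2$, $F(x,z_2)-F(x,z_1)=\int_{(z_1,z_2]}m^*(z)\,G(x,dz)$, a Lebesgue–Stieltjes integral with respect to the function $G(x,\cdot)$. Then the project is indexable with index $m^*$, and it is strongly threshold-indexable: in addition to indexability, for every $\lambda\in\mathbb R$ there is a threshold $z\in[-\infty,\infty]$ such that both the $z$-policy and the $z^-$-policy are $P_\lambda$-optimal. -/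

import Mathlib

open MeasureTheory ProbabilityTheory

namespace RestlessBandit

/-- The closed real interval `[ℓ, u]` with possibly infinite endpoints. -/
def stateSpace (l u : EReal) : Set ℝ := {x | l ≤ (x : EReal) ∧ (x : EReal) ≤ u}

/-- A discrete-time discounted restless bandit project with real states.  Actions are Booleans:
`true` is the active action `1`, `false` is the passive action `0`. -/
structure Project where
  /-- left endpoint of the state space -/
  l : EReal
  /-- right endpoint of the state space -/
  u : EReal
  l_lt_u : l < u
  /-- discount factor -/
  β : ℝ
  β_nonneg : 0 ≤ β
  β_lt_one : β < 1
  /-- one-period reward -/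
  r : stateSpace l u → Bool → ℝ
  /-- one-period resource consumption -/
  c : stateSpace l u → Bool → ℝ
  /-- transition law: `κ (x, a)` is the law of the next state when action `a` is taken in `x` -/
  κ : Kernel (stateSpace l u × Bool) (stateSpace l u)
  markov_κ : IsMarkovKernel κ

namespace Project

instance (P : Project) : IsMarkovKernel P.κ := P.markov_κ

/-- The state space. -/
abbrev State (P : Project) : Type := stateSpace P.l P.u

/-- The state-action space. -/
abbrev SA (P : Project) : Type := P.State × Bool

/-- The standing (weighted supremum norm) assumption. -/
def WeightedNormAssumption (P : Project) : Prop :=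
  (∀ a, Continuous fun x => P.r x a) ∧
  (∀ a, Continuous fun x => P.c x a) ∧
  (∀ x, 0 ≤ P.c x false ∧ P.c x false < P.c x true) ∧
  ∃ (w : P.State → ℝ) (M γ : ℝ), Measurable w ∧ (∀ x, 1 ≤ w x) ∧
    0 < M ∧ P.β ≤ γ ∧ γ < 1 ∧
    (∀ x a, |P.r x a| ≤ M * w x ∧ P.c x a ≤ M * w x) ∧
    (∀ x a, ENNReal.ofReal P.β * ∫⁻ y, ENNReal.ofReal (w y) ∂(P.κ (x, a)) ≤
      ENNReal.ofReal (γ * w x))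

/-- A history-dependent randomized policy: the action at time `t` is drawn from a probability
law that depends measurably on `((X₀, A₀), …, (X_{t-1}, A_{t-1}); X_t)`. -/
structure Policy (P : Project) where
  /-- decision rule at time `t` -/
  rule : (t : ℕ) → Kernel ((Fin t → P.SA) × P.State) Bool
  markov_rule : ∀ t, IsMarkovKernel (rule t)

instance (P : Project) (π : P.Policy) (t : ℕ) : IsMarkovKernel (π.rule t) := π.markov_rule t

/-- The conditional law of `(X_{n+1}, A_{n+1})` given `(X_0, A_0), …, (X_n, A_n)`:
`X_{n+1} ∼ κ (X_n, A_n)`, and then `A_{n+1}` is drawn by the decision rule at time `n + 1`. -/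
noncomputable def stepKernel (P : Project) (π : P.Policy) (n : ℕ) :
    Kernel (Finset.Iic n → P.SA) P.SA :=
  (P.κ.comap (fun h : Finset.Iic n → P.SA => h ⟨n, by simp⟩) (by fun_prop)) ⊗ₖ
    ((π.rule (n + 1)).comap
      (fun q : (Finset.Iic n → P.SA) × P.State =>
        ((fun i : Fin (n + 1) => q.1 ⟨(i : ℕ), by simpa using Nat.lt_succ_iff.mp i.isLt⟩), q.2))
      (by fun_prop))

instance (P : Project) (π : P.Policy) (n : ℕ) : IsMarkovKernel (P.stepKernel π n) := by
  unfold stepKernel; infer_instance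

/-- The law of the state-action path when `X₀ ∼ p` and policy `π` is used. -/
noncomputable def pathMeasure (P : Project) (p : Measure P.State) (π : P.Policy) :
    Measure (ℕ → P.SA) :=
  Kernel.trajMeasure (X := fun _ => P.SA)
    (p ⊗ₘ ((π.rule 0).comap (fun x : P.State => ((fun i : Fin 0 => i.elim0), x)) (by fun_prop)))
    (P.stepKernel π)

/-- Reward metric `F(p, π)`. -/
noncomputable def rewardFrom (P : Project) (p : Measure P.State) (π : P.Policy) : ℝ :=
  ∫ ω, ∑' t : ℕ, P.β ^ t * P.r (ω t).1 (ω t).2 ∂(P.pathMeasure p π)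

/-- Resource metric `G(p, π)`. -/
noncomputable def resourceFrom (P : Project) (p : Measure P.State) (π : P.Policy) : ℝ :=
  ∫ ω, ∑' t : ℕ, P.β ^ t * P.c (ω t).1 (ω t).2 ∂(P.pathMeasure p π)

/-- `F(x, π)`. -/
noncomputable def F (P : Project) (x : P.State) (π : P.Policy) : ℝ :=
  P.rewardFrom (Measure.dirac x) π

/-- `G(x, π)`. -/
noncomputable def G (P : Project) (x : P.State) (π : P.Policy) : ℝ :=
  P.resourceFrom (Measure.dirac x) π

/-- Net value `V_lam(x, π)` when the price per unit of resource is `lam`. -/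
noncomputable def V (P : Project) (lam : ℝ) (x : P.State) (π : P.Policy) : ℝ :=
  P.F x π - lam * P.G x π

/-- Optimal value function of the `lam`-price problem. -/
noncomputable def optV (P : Project) (lam : ℝ) (x : P.State) : ℝ :=
  ⨆ π : P.Policy, P.V lam x π

/-- `π` attains the supremum of the net value over all policies, from every initial state. -/
def IsOptimal (P : Project) (lam : ℝ) (π : P.Policy) : Prop :=
  ∀ x, IsLUB (Set.range fun π' : P.Policy => P.V lam x π') (P.V lam x π)

/-- `T_lam^a v (x) = r(x, a) - lam c(x, a) + β ∫ v dκ(x, a)`. -/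
noncomputable def bellman (P : Project) (lam : ℝ) (a : Bool) (v : P.State → ℝ) (x : P.State) : ℝ :=
  P.r x a - lam * P.c x a + P.β * ∫ y, v y ∂(P.κ (x, a))

/-- The set of states in which action `a` is optimal for the `lam`-price problem. -/
def optSet (P : Project) (lam : ℝ) (a : Bool) : Set P.State :=
  {x | P.bellman lam (!a) (P.optV lam) x ≤ P.bellman lam a (P.optV lam) x}

/-- The project is indexable with index `idx`. -/
def IndexableWith (P : Project) (idx : P.State → ℝ) : Prop :=
  ∀ lam : ℝ, P.optSet lam true = {x | lam ≤ idx x} ∧ P.optSet lam false = {x | idx x ≤ lam}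

/-- The project is indexable. -/
def Indexable (P : Project) : Prop := ∃ idx : P.State → ℝ, P.IndexableWith idx

open Classical in
/-- The stationary deterministic policy with active region `B`. -/
noncomputable def regionPolicy (P : Project) (B : Set P.State) (hB : MeasurableSet B) :
    P.Policy where
  rule t := Kernel.deterministic (fun q : (Fin t → P.SA) × P.State => decide (q.2 ∈ B))
    (Measurable.comp (g := fun x : P.State => decide (x ∈ B))
      (measurable_to_bool (by simpa [Set.preimage] using hB)) measurable_snd)
  markov_rule _ := inferInstance

/-- The `z`-policy: active iff the state is above `z`. -/
noncomputable def zPolicy (P : Project) (z : EReal) : P.Policy :=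
  P.regionPolicy {x | z < ((x : ℝ) : EReal)}
    (measurableSet_lt measurable_const (measurable_coe_real_ereal.comp measurable_subtype_coe))

/-- The `z⁻`-policy: active iff the state is at or above `z`. -/
noncomputable def zMinusPolicy (P : Project) (z : EReal) : P.Policy :=
  P.regionPolicy {x | z ≤ ((x : ℝ) : EReal)}
    (measurableSet_le measurable_const (measurable_coe_real_ereal.comp measurable_subtype_coe))

/-- Strong threshold-indexability. -/
def StronglyThresholdIndexable (P : Project) : Prop :=
  P.Indexable ∧
  ∀ lam : ℝ, ∃ z : EReal, P.IsOptimal lam (P.zPolicy z) ∧ P.IsOptimal lam (P.zMinusPolicy z)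

/-- The policy `⟨a, π⟩` that takes action `a` at time `0` and follows `π` from time `1` onwards
(as if time `1` were the initial time of `π`). -/
noncomputable def prependAction (P : Project) (a : Bool) (π : P.Policy) : P.Policy where
  rule
    | 0 => Kernel.const _ (Measure.dirac a)
    | t + 1 => (π.rule t).comap
        (fun q : (Fin (t + 1) → P.SA) × P.State => ((fun i : Fin t => q.1 i.succ), q.2))
        (by fun_prop)
  markov_rule
    | 0 => by dsimp only; infer_instance
    | t + 1 => by dsimp only; infer_instance

/-- Marginal reward metric `f(x, π)`. -/
noncomputable def f (P : Project) (x : P.State) (π : P.Policy) : ℝ :=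
  P.F x (P.prependAction true π) - P.F x (P.prependAction false π)

/-- Marginal resource metric `g(x, π)`. -/
noncomputable def g (P : Project) (x : P.State) (π : P.Policy) : ℝ :=
  P.G x (P.prependAction true π) - P.G x (P.prependAction false π)

/-- The marginal productivity index `m*(x) = f(x, x) / g(x, x)`. -/
noncomputable def mpIndex (P : Project) (x : P.State) : ℝ :=
  P.f x (P.zPolicy (x : ℝ)) / P.g x (P.zPolicy (x : ℝ))

/-- The point of the state space nearest to `z`. -/
noncomputable def clamp (P : Project) (z : ℝ) : P.State :=
  ⟨(max P.l (min (z : EReal) P.u)).toReal, by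
    have h1 : max P.l (min (z : EReal) P.u) ≠ ⊤ :=
      (max_lt (lt_of_lt_of_le P.l_lt_u le_top)
        (lt_of_le_of_lt (min_le_left _ _) (EReal.coe_lt_top z))).ne
    have h2 : max P.l (min (z : EReal) P.u) ≠ ⊥ :=
      (lt_of_lt_of_le (lt_min (EReal.bot_lt_coe z) (lt_of_le_of_lt bot_le P.l_lt_u))
        (le_max_right _ _)).ne'
    have h3 := EReal.coe_toReal h1 h2
    constructor
    · rw [h3]; exact le_max_left _ _
    · rw [h3]; exact max_le P.l_lt_u.le (min_le_right _ _)⟩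

/-- The extension of the index to `ℝ`, constant to the left of `ℓ` and to the right of `u`. -/
noncomputable def mpIndexExt (P : Project) (z : ℝ) : ℝ := P.mpIndex (P.clamp z)

end Project

open Classical in
/-- The Lebesgue–Stieltjes integral `∫_S J dα` with respect to a function `α` of bounded variation
on `ℝ` (it is set to `0` if `α` is not of bounded variation). -/
noncomputable def lsIntegral (J α : ℝ → ℝ) (S : Set ℝ) : ℝ :=
  if h : BoundedVariationOn α Set.univ then
    VectorMeasure.integral (h.vectorMeasure.restrict S) J (ContinuousLinearMap.lsmul ℝ ℝ)
  else 0

namespace Project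

/-- (PCLI1): positive marginal resource metric, for all states and all thresholds. -/
def PCLI1 (P : Project) : Prop := ∀ (x : P.State) (z : EReal), 0 < P.g x (P.zPolicy z)

/-- (PCLI2): the marginal productivity index is nondecreasing, continuous, bounded below. -/
def PCLI2 (P : Project) : Prop :=
  Monotone P.mpIndex ∧ Continuous P.mpIndex ∧ BddBelow (Set.range P.mpIndex)

/-- (PCLI3): `F(x, ·)` is an indefinite Lebesgue–Stieltjes integral of the index with respect to
`G(x, ·)`. -/
def PCLI3 (P : Project) : Prop :=
  ∀ (x : P.State) (z₁ z₂ : ℝ), z₁ < z₂ →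
    P.F x (P.zPolicy z₂) - P.F x (P.zPolicy z₁) =
      lsIntegral P.mpIndexExt (fun z : ℝ => P.G x (P.zPolicy z)) (Set.Ioc z₁ z₂)

/-- PCL-indexability (with respect to threshold policies). -/
def PCLIndexable (P : Project) : Prop := P.PCLI1 ∧ P.PCLI2 ∧ P.PCLI3

end Project

end RestlessBandit

namespace RestlessBandit

open Filter Topology Set

/-! ### Lebesgue–Stieltjes integrals against antitone functions; integration by parts. -/

section LebesgueStieltjes

/-! Write m for the extended index, and f, g for the marginal metrics. By policy improvement,
(PCLI1) makes G(x,·) antitone; it is also bounded and right-continuous. Since m is continuous and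
monotone, (PCLI3) can be integrated by parts: F(x,b) - F(x,a) = m(b)G(x,b) - m(a)G(x,a) - ∫_{(a,b]}
G(x,t) dm(t). In this form the identity is linear in F and G, so it survives averaging over the next
state (Fubini) and passes to f and g (`marginal_by_parts`).

Anchoring it at the state by f(x,x) = m(x)g(x,x) gives f(x,z) - λg(x,z) = (m(z)-λ)g(x,z) - ∫_{(x,z]}
g(x,t) dm(t) for z ≥ x, and the analogue with + ∫_{(z,x]} for z ≤ x. If m(z) = λ, only the integral
remains, and because g > 0 its sign is exactly that of m(x) - λ. If λ is not a value of m, then m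
stays on one side of λ, and z = ∞ or z = -∞ works by a limit argument (`exists_threshold`).

The value of the z-policy in the λ-price problem therefore solves the Bellman optimality equation.
The performance-difference identity `hasSum_advantage` turns this into optimality among all
history-dependent policies. In the state z itself both actions are optimal, so the z⁻-policy has the
same value, and the sign of f - λg identifies the optimal actions in every state. -/

theorem _root_.Antitone.boundedVariationOn_of_abs_le {α : ℝ → ℝ} (hα : Antitone α) {C : ℝ}
    (hC : ∀ t, |α t| ≤ C) : BoundedVariationOn α univ := by
  refine ne_top_of_le_ne_top (ENNReal.ofReal_ne_top (r := C + C)) (iSup_le fun p => ?_)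
  obtain ⟨n, u, hu, -⟩ := p
  have h (i : ℕ) : edist (α (u (i + 1))) (α (u i)) = ENNReal.ofReal (α (u i) - α (u (i + 1))) := by
    rw [edist_comm, edist_dist, Real.dist_eq, abs_of_nonneg (sub_nonneg.2 (hα (hu i.le_succ)))]
  simp only [h]
  rw [← ENNReal.ofReal_sum_of_nonneg fun i _ => sub_nonneg.2 (hα (hu i.le_succ)),
    Finset.sum_range_sub' (fun i => α (u i))]
  exact ENNReal.ofReal_le_ofReal (by linarith [abs_le.1 (hC (u 0)), abs_le.1 (hC (u n))])

/-- The Stieltjes function `-α` of a right-continuous antitone function `α`. -/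
noncomputable def negStieltjes (α : ℝ → ℝ) (hα : Antitone α)
    (hr : ∀ t, ContinuousWithinAt α (Ici t) t) : StieltjesFunction ℝ where
  toFun t := -α t
  mono' _ _ h := neg_le_neg (hα h)
  right_continuous' t := (hr t).neg

theorem vectorMeasure_eq_neg_toSignedMeasure {α : ℝ → ℝ} (hα : Antitone α)
    (hr : ∀ t, ContinuousWithinAt α (Ici t) t) (h : BoundedVariationOn α univ)
    [IsFiniteMeasure (negStieltjes α hα hr).measure] :
    h.vectorMeasure = -(negStieltjes α hα hr).measure.toSignedMeasure := by
  have hlim (t : ℝ) : Function.rightLim α t = α t :=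
    (hr t).rightLim_eq
  have hIoc : ∀ a b : ℝ, a < b →
      h.vectorMeasure (Ioc a b) = (-(negStieltjes α hα hr).measure.toSignedMeasure) (Ioc a b) := by
    intro a b hab
    rw [h.vectorMeasure_Ioc hab.le, hlim, hlim, _root_.neg_apply,
      Measure.toSignedMeasure_apply_measurable measurableSet_Ioc, measureReal_def,
      StieltjesFunction.measure_Ioc, ENNReal.toReal_ofReal]
    · simp [negStieltjes]; ring
    · simpa [negStieltjes] using hα hab.le
  refine VectorMeasure.ext_of_generateFrom {S | ∃ l u : ℝ, l < u ∧ Ioc l u = S} ?_ ?_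
    (isPiSystem_Ioc id id) ?_
  · rintro s ⟨a, b, hab, rfl⟩
    exact hIoc a b hab
  · rw [← borel_eq_generateFrom_Ioc ℝ]
    exact BorelSpace.measurable_eq
  -- The whole line is not in the π-system of bounded intervals, so equality of the total masses is
  -- obtained by exhaustion.
  · have hU : (⋃ n : ℕ, Ioc (-(n : ℝ)) n) = univ := by
      refine eq_univ_of_forall fun x => mem_iUnion.2 ?_
      obtain ⟨n, hn⟩ := exists_nat_gt |x|
      exact ⟨n, by linarith [neg_abs_le x], by linarith [le_abs_self x]⟩
    have hmono : Monotone fun n : ℕ => Ioc (-(n : ℝ)) n := fun m n hmn =>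
      Ioc_subset_Ioc (by simpa using hmn) (by simpa using hmn)
    have h1 := h.vectorMeasure.tendsto_vectorMeasure_iUnion_atTop_nat hmono
      (fun n => measurableSet_Ioc)
    have h2 := VectorMeasure.tendsto_vectorMeasure_iUnion_atTop_nat
      (v := -(negStieltjes α hα hr).measure.toSignedMeasure) hmono (fun n => measurableSet_Ioc)
    rw [hU] at h1 h2
    refine tendsto_nhds_unique h1 (h2.congr' ?_)
    -- For `n = 0` the interval is degenerate, and `hIoc` asks for `a < b`.
    filter_upwards [eventually_gt_atTop 0] with n hn
    have : (0 : ℝ) < n := by exact_mod_cast hn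
    exact (hIoc _ _ (by linarith)).symm

/-- The bound on `α` gives bounded variation and so excludes the default value `0` of `lsIntegral`;
the minus sign appears because `-α`, not `α`, induces a positive measure. -/
theorem lsIntegral_of_antitone {α : ℝ → ℝ} (hα : Antitone α) {C : ℝ} (hC : ∀ t, |α t| ≤ C)
    (hr : ∀ t, ContinuousWithinAt α (Ici t) t) (J : ℝ → ℝ) {S : Set ℝ} (hS : MeasurableSet S) :
    lsIntegral J α S = -∫ t in S, J t ∂(negStieltjes α hα hr).measure := by
  have hbv := hα.boundedVariationOn_of_abs_le hC
  have : IsFiniteMeasure (negStieltjes α hα hr).measure :=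
    StieltjesFunction.isFiniteMeasure_of_forall_abs_le (C := C) _
      (fun x => by simpa [negStieltjes] using hC x)
  have hflip : ContinuousLinearMap.lsmul ℝ ℝ = (ContinuousLinearMap.lsmul ℝ ℝ (E := ℝ)).flip := by
    ext; simp
  rw [lsIntegral, dif_pos hbv, vectorMeasure_eq_neg_toSignedMeasure hα hr hbv, hflip]
  have : VectorMeasure.restrict (-(negStieltjes α hα hr).measure.toSignedMeasure) S
      = -(VectorMeasure.restrict (negStieltjes α hα hr).measure.toSignedMeasure S) := by
    ext t ht
    simp [VectorMeasure.restrict_apply, hS, ht]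
  rw [this, VectorMeasure.integral_neg_vectorMeasure, VectorMeasure.setIntegral_toSignedMeasure hS]

/-- The Stieltjes function of a continuous monotone function. -/
noncomputable def contStieltjes (J : ℝ → ℝ) (hJ : Monotone J) (hc : Continuous J) :
    StieltjesFunction ℝ where
  toFun := J
  mono' := hJ
  right_continuous' _ := hc.continuousWithinAt

theorem contStieltjes_real_Ioo {J : ℝ → ℝ} (hJ : Monotone J) (hc : Continuous J) {a b : ℝ}
    (h : a ≤ b) : (contStieltjes J hJ hc).measure.real (Ioo a b) = J b - J a := by
  rw [measureReal_def, StieltjesFunction.measure_Ioo,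
    show Function.leftLim (contStieltjes J hJ hc) b = J b from
      (hc.continuousWithinAt (s := Iic b)).leftLim_eq,
    show contStieltjes J hJ hc a = J a from rfl, ENNReal.toReal_ofReal (sub_nonneg.2 (hJ h))]

/-- Integration by parts for the Lebesgue-Stieltjes integral of a continuous monotone function
with respect to a bounded right-continuous antitone function. -/
theorem lsIntegral_Ioc_by_parts {α J : ℝ → ℝ} (hα : Antitone α) {C : ℝ} (hC : ∀ t, |α t| ≤ C)
    (hr : ∀ t, ContinuousWithinAt α (Ici t) t) (hJ : Monotone J) (hc : Continuous J)
    {a b : ℝ} (hab : a < b) :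
    lsIntegral J α (Ioc a b) =
      J b * α b - J a * α a - ∫ t in Ioc a b, α t ∂(contStieltjes J hJ hc).measure := by
  rw [lsIntegral_of_antitone hα hC hr J measurableSet_Ioc]
  set μ := (negStieltjes α hα hr).measure with hμ
  set m := (contStieltjes J hJ hc).measure with hm
  have : IsFiniteMeasure μ :=
    StieltjesFunction.isFiniteMeasure_of_forall_abs_le (C := C) _
      (fun x => by simpa [negStieltjes] using hC x)
  have hμIoc {s t : ℝ} (h : s ≤ t) : μ.real (Ioc s t) = α s - α t := by
    rw [measureReal_def, hμ, StieltjesFunction.measure_Ioc, ENNReal.toReal_ofReal]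
    · simp [negStieltjes]; ring
    · simpa [negStieltjes] using hα h
  have hmIoc : m.real (Ioc a b) = J b - J a := by
    rw [measureReal_def, hm, StieltjesFunction.measure_Ioc, ENNReal.toReal_ofReal]
    · rfl
    · exact sub_nonneg.2 (hJ hab.le)
  have hmtop : m (Ioc a b) ≠ ⊤ := by
    rw [hm, StieltjesFunction.measure_Ioc]; exact ENNReal.ofReal_ne_top
  have : IsFiniteMeasure (m.restrict (Ioc a b)) := ⟨by simpa using hmtop.lt_top⟩
  -- Integrate the indicator of the triangle t < s over the square (a,b]² in both orders. The
  -- sections are (t,b], of `μ`-mass `α t - α b`, and (a,s), of `m`-mass `J s - J a`; the latter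
  -- uses that `J` is continuous, so `m` has no atom at s.
  let D : Set (ℝ × ℝ) := {p | p.1 < p.2}
  have hD : MeasurableSet D := measurableSet_lt measurable_fst measurable_snd
  have hint : Integrable (Function.uncurry fun t s : ℝ => D.indicator (fun _ => (1 : ℝ)) (t, s))
      ((m.restrict (Ioc a b)).prod (μ.restrict (Ioc a b))) := by
    simpa [Function.uncurry_def] using (integrable_const (1 : ℝ)).indicator hD
  have hswap := integral_integral_swap hint
  have hL : ∀ t ∈ Ioc a b, ∫ s in Ioc a b, D.indicator (fun _ => (1 : ℝ)) (t, s) ∂μ = α t - α b := by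
    intro t ht
    have : (fun s => D.indicator (fun _ => (1 : ℝ)) (t, s)) = (Ioi t).indicator fun _ => 1 := by
      ext s; simp [D, indicator]
    rw [this, integral_indicator measurableSet_Ioi, Measure.restrict_restrict measurableSet_Ioi,
      ← hμIoc ht.2]
    simp only [integral_const, smul_eq_mul, mul_one, measureReal_restrict_apply_univ]
    congr 1
    ext s; simp only [mem_inter_iff, mem_Ioi, mem_Ioc]
    exact ⟨fun h => ⟨h.1, h.2.2⟩, fun h => ⟨h.1, ht.1.trans h.1, h.2⟩⟩
  have hR : ∀ s ∈ Ioc a b, ∫ t in Ioc a b, D.indicator (fun _ => (1 : ℝ)) (t, s) ∂m = J s - J a := by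
    intro s hs
    have : (fun t => D.indicator (fun _ => (1 : ℝ)) (t, s)) = (Iio s).indicator fun _ => 1 := by
      ext t; simp [D, indicator]
    rw [this, integral_indicator measurableSet_Iio, Measure.restrict_restrict measurableSet_Iio,
      ← contStieltjes_real_Ioo hJ hc hs.1.le]
    simp only [integral_const, smul_eq_mul, mul_one, measureReal_restrict_apply_univ]
    congr 1
    ext t; simp only [mem_inter_iff, mem_Iio, mem_Ioc, mem_Ioo]
    exact ⟨fun h => ⟨h.2.1, h.1⟩, fun h => ⟨h.2, h.1, h.2.le.trans hs.2⟩⟩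
  rw [setIntegral_congr_fun measurableSet_Ioc hL, setIntegral_congr_fun measurableSet_Ioc hR,
    integral_sub, integral_sub] at hswap
  · simp only [integral_const, smul_eq_mul, measureReal_restrict_apply_univ, hmIoc,
      hμIoc hab.le] at hswap
    linear_combination hswap
  · refine Measure.integrableOn_of_bounded (M := max |J a| |J b|) (measure_ne_top _ _)
      hc.aestronglyMeasurable ?_
    filter_upwards [ae_restrict_mem measurableSet_Ioc] with t ht
    exact abs_le_max_abs_abs (hJ ht.1.le) (hJ ht.2)
  · exact integrable_const _
  · exact Measure.integrableOn_of_bounded (M := C) hmtop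
      hα.measurable.aestronglyMeasurable (Eventually.of_forall fun t => hC t)
  · exact integrable_const _

end LebesgueStieltjes

namespace Project

/-! ### One-time laws of the state-action process. -/

section Law

variable (P : Project)

/-- The law of the state-action pair at time `t`. -/
noncomputable def law (x : P.State) (π : P.Policy) (t : ℕ) : Measure P.SA :=
  (P.pathMeasure (Measure.dirac x) π).map fun ω => ω t

/-- The law of the state-action pair at time `0`. -/
noncomputable def initLaw (x : P.State) (π : P.Policy) : Measure P.SA :=
  Measure.dirac x ⊗ₘ
    ((π.rule 0).comap (fun x : P.State => ((fun i : Fin 0 => i.elim0), x)) (by fun_prop))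

instance (x : P.State) (π : P.Policy) : IsProbabilityMeasure (P.initLaw x π) := by
  unfold initLaw; infer_instance

instance (x : P.State) (π : P.Policy) :
    IsProbabilityMeasure (P.pathMeasure (Measure.dirac x) π) :=
  inferInstanceAs (IsProbabilityMeasure
    (Kernel.trajMeasure (X := fun _ => P.SA) (P.initLaw x π) (P.stepKernel π)))

instance (x : P.State) (π : P.Policy) (t : ℕ) : IsProbabilityMeasure (P.law x π t) :=
  Measure.isProbabilityMeasure_map (measurable_pi_apply t).aemeasurable

theorem law_zero (x : P.State) (π : P.Policy) : P.law x π 0 = P.initLaw x π := by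
  have h1 : (P.pathMeasure (Measure.dirac x) π).map (Preorder.frestrictLe 0) =
      (P.initLaw x π).map (MeasurableEquiv.piUnique (fun _ : Finset.Iic 0 => P.SA)).symm := by
    rw [pathMeasure, Kernel.trajMeasure, Measure.map_comp _ _ (by fun_prop),
      Kernel.traj_map_frestrictLe, Kernel.partialTraj_self, Measure.id_comp]
    rfl
  have h2 : P.law x π 0 = ((P.pathMeasure (Measure.dirac x) π).map (Preorder.frestrictLe 0)).map
      fun h : (i : Finset.Iic 0) → P.SA => h ⟨0, by simp⟩ := by
    rw [Measure.map_map (by fun_prop) (by fun_prop)]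
    rfl
  rw [h2, h1, Measure.map_map (by fun_prop) (by fun_prop)]
  exact Measure.map_id

/-- The law of the history up to time `t`. -/
noncomputable def histLaw (x : P.State) (π : P.Policy) (t : ℕ) : Measure (Finset.Iic t → P.SA) :=
  (P.pathMeasure (Measure.dirac x) π).map (Preorder.frestrictLe (π := fun _ => P.SA) t)

instance (x : P.State) (π : P.Policy) (t : ℕ) : IsProbabilityMeasure (P.histLaw x π t) :=
  Measure.isProbabilityMeasure_map (by fun_prop)

theorem law_succ (x : P.State) (π : P.Policy) (t : ℕ) :
    P.law x π (t + 1) = P.stepKernel π t ∘ₘ P.histLaw x π t := by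
  have h := Kernel.map_frestrictLe_trajMeasure_compProd_eq_map_trajMeasure
    (X := fun _ => P.SA) (μ₀ := P.initLaw x π) (κ := P.stepKernel π) (a := t)
  have h' := congrArg Measure.snd h
  rw [Measure.snd_compProd, Measure.snd, Measure.map_map (by fun_prop) (by fun_prop)] at h'
  exact h'.symm

theorem map_histLaw (x : P.State) (π : P.Policy) (t : ℕ) :
    (P.histLaw x π t).map (fun h => h ⟨t, by simp⟩) = P.law x π t := by
  rw [histLaw, Measure.map_map (by fun_prop) (by fun_prop)]
  rfl

/-- However the policy uses the history, the next state depends on it only through the current pair.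
This gives a one-step recursion for expectations of state functions under every policy. -/
theorem map_fst_law_succ (x : P.State) (π : P.Policy) (t : ℕ) :
    (P.law x π (t + 1)).map Prod.fst = P.κ ∘ₘ P.law x π t := by
  have hm : Measurable fun h : Finset.Iic t → P.SA => h ⟨t, by simp⟩ := measurable_pi_apply _
  have h1 : (P.stepKernel π t).map Prod.fst = P.κ.comap _ hm := by
    rw [← Kernel.fst_eq, stepKernel, Kernel.fst_compProd]
  rw [law_succ, Measure.map_comp _ _ measurable_fst, h1, ← Kernel.comp_deterministic_eq_comap,
    ← Measure.comp_assoc, Measure.deterministic_comp_eq_map, map_histLaw]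

theorem lintegral_law_succ (x : P.State) (π : P.Policy) (t : ℕ) {φ : P.State → ENNReal}
    (hφ : Measurable φ) :
    ∫⁻ p, φ p.1 ∂P.law x π (t + 1) = ∫⁻ p, ∫⁻ y, φ y ∂P.κ p ∂P.law x π t := by
  rw [← lintegral_map hφ measurable_fst, map_fst_law_succ,
    Measure.lintegral_bind P.κ.measurable.aemeasurable hφ.aemeasurable]

theorem integral_law_succ (x : P.State) (π : P.Policy) (t : ℕ) {φ : P.State → ℝ}
    (hφ : Measurable φ) (hint : Integrable (fun p => φ p.1) (P.law x π (t + 1))) :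
    ∫ p, φ p.1 ∂P.law x π (t + 1) = ∫ p, ∫ y, φ y ∂P.κ p ∂P.law x π t := by
  have h : Integrable φ (P.κ ∘ₘ P.law x π t) := by
    rw [← map_fst_law_succ]
    exact (integrable_map_measure hφ.aestronglyMeasurable measurable_fst.aemeasurable).2 hint
  rw [← integral_map measurable_fst.aemeasurable hφ.aestronglyMeasurable, map_fst_law_succ]
  rw [← Measure.snd_compProd, Measure.snd] at h ⊢
  rw [integral_map measurable_snd.aemeasurable hφ.aestronglyMeasurable, Measure.integral_compProd]
  exact (integrable_map_measure hφ.aestronglyMeasurable measurable_snd.aemeasurable).1 h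

theorem ae_law_succ_of_rule_eq_dirac (x : P.State) (π : P.Policy) (t : ℕ) {a : P.State → Bool}
    (ha : Measurable a) (hπ : ∀ q, π.rule (t + 1) q = Measure.dirac (a q.2)) :
    ∀ᵐ p ∂P.law x π (t + 1), p.2 = a p.1 := by
  have hm : MeasurableSet {p : P.SA | p.2 = a p.1} :=
    measurableSet_eq_fun measurable_snd (ha.comp measurable_fst)
  rw [law_succ]
  refine Measure.ae_comp_of_ae_ae hm (Eventually.of_forall fun h => ?_)
  refine Kernel.ae_compProd_of_ae_ae hm (Eventually.of_forall fun y => ?_)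
  rw [Kernel.comap_apply, hπ]
  simp [ae_dirac_eq]

theorem initLaw_of_rule_eq_dirac (x : P.State) (π : P.Policy) {b : Bool}
    (hπ : ∀ q : (Fin 0 → P.SA) × P.State, q.2 = x → π.rule 0 q = Measure.dirac b) :
    P.initLaw x π = Measure.dirac (x, b) := by
  ext s hs
  rw [initLaw, Measure.dirac_compProd_apply hs, Kernel.comap_apply, hπ _ rfl,
    Measure.dirac_apply' _ hs, Measure.dirac_apply' _ (measurable_prodMk_left hs)]
  rfl

theorem map_fst_initLaw (x : P.State) (π : P.Policy) :
    (P.initLaw x π).map Prod.fst = Measure.dirac x := by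
  rw [initLaw]
  exact Measure.fst_compProd _ _

end Law

/-! ### Weighted-norm bounds and the performance-difference identity. -/

/-- A weight function that contracts in expectation, after discounting, at rate `γ < 1`. -/
structure ContractingWeight (P : Project) (w : P.State → ℝ) (γ : ℝ) : Prop where
  measurable : Measurable w
  one_le : ∀ x, 1 ≤ w x
  nonneg : 0 ≤ γ
  lt_one : γ < 1
  lintegral_le : ∀ p : P.SA, ENNReal.ofReal P.β * ∫⁻ y, ENNReal.ofReal (w y) ∂(P.κ p) ≤
    ENNReal.ofReal (γ * w p.1)

/-- `v` is measurable and bounded by `C` in the `w`-norm. -/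
structure WBounded {P : Project} (w : P.State → ℝ) (C : ℝ) (v : P.State → ℝ) : Prop where
  measurable : Measurable v
  abs_le : ∀ x, |v x| ≤ C * w x

/-- `h` is measurable and bounded by `M` in the `w`-norm, uniformly in the action. -/
structure WBoundedCost {P : Project} (w : P.State → ℝ) (M : ℝ) (h : P.State → Bool → ℝ) :
    Prop where
  measurable : Measurable fun p : P.SA => h p.1 p.2
  abs_le : ∀ x a, |h x a| ≤ M * w x

/-- Total discounted value of the one-period quantity `h`. -/
noncomputable def total (P : Project) (h : P.State → Bool → ℝ) (x : P.State) (π : P.Policy) : ℝ :=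
  ∫ ω, ∑' t : ℕ, P.β ^ t * h (ω t).1 (ω t).2 ∂(P.pathMeasure (Measure.dirac x) π)

/-- The advantage of taking action `p.2` in state `p.1` over the continuation value `v`. -/
noncomputable def advantage (P : Project) (h : P.State → Bool → ℝ) (v : P.State → ℝ) (p : P.SA) :
    ℝ :=
  h p.1 p.2 + P.β * ∫ y, v y ∂P.κ p - v p.1

variable {P : Project} {w : P.State → ℝ} {γ C M : ℝ} {v : P.State → ℝ}
  {h : P.State → Bool → ℝ}

namespace ContractingWeight

theorem nonneg_weight (hw : P.ContractingWeight w γ) (x : P.State) : 0 ≤ w x :=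
  zero_le_one.trans (hw.one_le x)

/-- The factor `P.β` is kept inside the integral: for `P.β = 0` the weight itself need not be
integrable, but `P.β * w` always is. -/
theorem lintegral_discount_le (hw : P.ContractingWeight w γ) (p : P.SA) :
    ∫⁻ y, ENNReal.ofReal (P.β * w y) ∂(P.κ p) ≤ ENNReal.ofReal (γ * w p.1) := by
  simp only [ENNReal.ofReal_mul P.β_nonneg]
  rw [lintegral_const_mul _ hw.measurable.ennreal_ofReal]
  exact hw.lintegral_le p

theorem integrable_discount (hw : P.ContractingWeight w γ) (p : P.SA) :
    Integrable (fun y => P.β * w y) (P.κ p) :=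
  (lintegral_ofReal_ne_top_iff_integrable (hw.measurable.const_mul _).aestronglyMeasurable
    (Eventually.of_forall fun y => mul_nonneg P.β_nonneg (hw.nonneg_weight y))).1
    (ne_top_of_le_ne_top ENNReal.ofReal_ne_top (hw.lintegral_discount_le p))

theorem integral_discount_le (hw : P.ContractingWeight w γ) (p : P.SA) :
    ∫ y, P.β * w y ∂(P.κ p) ≤ γ * w p.1 := by
  rw [integral_eq_lintegral_of_nonneg_ae
    (Eventually.of_forall fun y => mul_nonneg P.β_nonneg (hw.nonneg_weight y))
    (hw.measurable.const_mul _).aestronglyMeasurable]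
  exact ENNReal.toReal_le_of_le_ofReal (mul_nonneg hw.nonneg (hw.nonneg_weight _))
    (hw.lintegral_discount_le p)

theorem lintegral_law_le (hw : P.ContractingWeight w γ) (x : P.State) (π : P.Policy) (t : ℕ) :
    ∫⁻ p, ENNReal.ofReal (P.β ^ t * w p.1) ∂P.law x π t ≤ ENNReal.ofReal (γ ^ t * w x) := by
  induction t with
  | zero =>
    simp only [pow_zero, one_mul]
    rw [law_zero, ← lintegral_map (f := fun y => ENNReal.ofReal (w y))
      hw.measurable.ennreal_ofReal measurable_fst, map_fst_initLaw,
      lintegral_dirac' _ hw.measurable.ennreal_ofReal]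
  | succ t ih =>
    rw [P.lintegral_law_succ x π t (φ := fun y => ENNReal.ofReal (P.β ^ (t + 1) * w y))
      (hw.measurable.const_mul _).ennreal_ofReal]
    calc ∫⁻ p, ∫⁻ y, ENNReal.ofReal (P.β ^ (t + 1) * w y) ∂P.κ p ∂P.law x π t
        ≤ ∫⁻ p, ENNReal.ofReal γ * ENNReal.ofReal (P.β ^ t * w p.1) ∂P.law x π t := by
          refine lintegral_mono fun p => ?_
          simp only [pow_succ, mul_assoc, ENNReal.ofReal_mul (pow_nonneg P.β_nonneg t)]
          rw [lintegral_const_mul _ (hw.measurable.const_mul _).ennreal_ofReal, mul_left_comm,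
            ← ENNReal.ofReal_mul hw.nonneg]
          gcongr
          exact hw.lintegral_discount_le p
      _ ≤ ENNReal.ofReal γ * ENNReal.ofReal (γ ^ t * w x) := by
          have hm : Measurable fun p : P.SA => w p.1 := hw.measurable.comp measurable_fst
          rw [lintegral_const_mul _ (hm.const_mul _).ennreal_ofReal]
          gcongr
      _ = ENNReal.ofReal (γ ^ (t + 1) * w x) := by
          rw [← ENNReal.ofReal_mul hw.nonneg, pow_succ']
          ring_nf

theorem integrable_law (hw : P.ContractingWeight w γ) (x : P.State) (π : P.Policy) (t : ℕ) :
    Integrable (fun p : P.SA => P.β ^ t * w p.1) (P.law x π t) :=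
  (lintegral_ofReal_ne_top_iff_integrable
    ((hw.measurable.comp measurable_fst).const_mul _).aestronglyMeasurable
    (Eventually.of_forall fun _ =>
      mul_nonneg (pow_nonneg P.β_nonneg t) (hw.nonneg_weight _))).1
    (ne_top_of_le_ne_top ENNReal.ofReal_ne_top (hw.lintegral_law_le x π t))

theorem integral_law_le (hw : P.ContractingWeight w γ) (x : P.State) (π : P.Policy) (t : ℕ) :
    ∫ p, P.β ^ t * w p.1 ∂P.law x π t ≤ γ ^ t * w x := by
  rw [integral_eq_lintegral_of_nonneg_ae
    (Eventually.of_forall fun p => mul_nonneg (pow_nonneg P.β_nonneg t) (hw.nonneg_weight _))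
    ((hw.measurable.comp measurable_fst).const_mul _).aestronglyMeasurable]
  exact ENNReal.toReal_le_of_le_ofReal
    (mul_nonneg (pow_nonneg hw.nonneg t) (hw.nonneg_weight _)) (hw.lintegral_law_le x π t)

end ContractingWeight

theorem WBounded.integrable_discount (hv : WBounded w C v) (hw : P.ContractingWeight w γ)
    (p : P.SA) : Integrable (fun y => P.β * v y) (P.κ p) := by
  refine ((hw.integrable_discount p).const_mul C).mono'
    (hv.measurable.const_mul _).aestronglyMeasurable (Eventually.of_forall fun y => ?_)
  rw [Real.norm_eq_abs, abs_mul, abs_of_nonneg P.β_nonneg, mul_left_comm]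
  exact mul_le_mul_of_nonneg_left (hv.abs_le y) P.β_nonneg

theorem WBounded.const_nonneg (hv : WBounded w C v) (hw : P.ContractingWeight w γ)
    (x : P.State) : 0 ≤ C := by
  by_contra! hC
  nlinarith [hv.abs_le x, abs_nonneg (v x), hw.one_le x]

theorem WBounded.abs_integral_le (hv : WBounded w C v) (hw : P.ContractingWeight w γ)
    (p : P.SA) : |P.β * ∫ y, v y ∂P.κ p| ≤ C * γ * w p.1 := by
  rw [← integral_const_mul, mul_assoc]
  calc |∫ y, P.β * v y ∂P.κ p| ≤ ∫ y, C * (P.β * w y) ∂P.κ p := by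
        rw [← Real.norm_eq_abs]
        refine norm_integral_le_of_norm_le ((hw.integrable_discount p).const_mul C)
          (Eventually.of_forall fun y => ?_)
        rw [Real.norm_eq_abs, abs_mul, abs_of_nonneg P.β_nonneg, mul_left_comm]
        exact mul_le_mul_of_nonneg_left (hv.abs_le y) P.β_nonneg
    _ ≤ C * (γ * w p.1) := by
        rw [integral_const_mul]
        exact mul_le_mul_of_nonneg_left (hw.integral_discount_le p) (hv.const_nonneg hw p.1)

theorem WBounded.sub {C' : ℝ} {v' : P.State → ℝ} (hv : WBounded w C v) (hv' : WBounded w C' v') :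
    WBounded w (C + C') (fun y => v y - v' y) where
  measurable := hv.measurable.sub hv'.measurable
  abs_le y := by linarith [abs_sub (v y) (v' y), hv.abs_le y, hv'.abs_le y]

theorem WBounded.const_mul (hv : WBounded w C v) (c : ℝ) :
    WBounded w (|c| * C) (fun y => c * v y) where
  measurable := hv.measurable.const_mul c
  abs_le y := by
    rw [abs_mul, mul_assoc]
    exact mul_le_mul_of_nonneg_left (hv.abs_le y) (abs_nonneg c)

theorem WBounded.measurable_integral (hv : WBounded w C v) :
    Measurable fun p : P.SA => ∫ y, v y ∂P.κ p :=
  hv.measurable.stronglyMeasurable.integral_kernel.measurable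

theorem WBoundedCost.advantage (hh : WBoundedCost w M h) (hv : WBounded w C v)
    (hw : P.ContractingWeight w γ) :
    WBoundedCost w (M + C * γ + C) fun x a => P.advantage h v (x, a) where
  measurable := (hh.measurable.add (hv.measurable_integral.const_mul _)).sub
    (hv.measurable.comp measurable_fst)
  abs_le x a := by
    have h1 := _root_.abs_le.1 (hh.abs_le x a)
    have h2 := _root_.abs_le.1 (hv.abs_integral_le hw (x, a))
    have h3 := _root_.abs_le.1 (hv.abs_le x)
    simp only at h2
    rw [Project.advantage, _root_.abs_le]
    constructor <;> linarith [h1.1, h1.2, h2.1, h2.2, h3.1, h3.2]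

theorem WBoundedCost.integrable_law (hh : WBoundedCost w M h) (hw : P.ContractingWeight w γ)
    (x : P.State) (π : P.Policy) (t : ℕ) :
    Integrable (fun p : P.SA => P.β ^ t * h p.1 p.2) (P.law x π t) := by
  refine ((hw.integrable_law x π t).const_mul M).mono'
    (hh.measurable.const_mul _).aestronglyMeasurable (Eventually.of_forall fun p => ?_)
  rw [Real.norm_eq_abs, abs_mul, abs_of_nonneg (pow_nonneg P.β_nonneg t), mul_left_comm]
  exact mul_le_mul_of_nonneg_left (hh.abs_le _ _) (pow_nonneg P.β_nonneg t)

theorem WBoundedCost.integral_norm_law_le (hh : WBoundedCost w M h)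
    (hw : P.ContractingWeight w γ) (hM : 0 ≤ M) (x : P.State) (π : P.Policy) (t : ℕ) :
    ∫ p, ‖P.β ^ t * h p.1 p.2‖ ∂P.law x π t ≤ M * w x * γ ^ t := by
  calc ∫ p, ‖P.β ^ t * h p.1 p.2‖ ∂P.law x π t ≤ ∫ p, M * (P.β ^ t * w p.1) ∂P.law x π t := by
        refine integral_mono (hh.integrable_law hw x π t).norm
          ((hw.integrable_law x π t).const_mul M) fun p => ?_
        simp only [Real.norm_eq_abs]
        rw [abs_mul, abs_of_nonneg (pow_nonneg P.β_nonneg t), mul_left_comm]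
        exact mul_le_mul_of_nonneg_left (hh.abs_le _ _) (pow_nonneg P.β_nonneg t)
    _ ≤ M * w x * γ ^ t := by
        rw [integral_const_mul, mul_assoc, mul_comm (w x)]
        exact mul_le_mul_of_nonneg_left (hw.integral_law_le x π t) hM

/-- The geometric bound `γ ^ t` allows exchanging sum and expectation, so totals depend on the path
measure only through the laws `P.law x π t`. -/
theorem WBoundedCost.hasSum_total (hh : WBoundedCost w M h) (hw : P.ContractingWeight w γ)
    (hM : 0 ≤ M) (x : P.State) (π : P.Policy) :
    HasSum (fun t => ∫ p, P.β ^ t * h p.1 p.2 ∂P.law x π t) (P.total h x π) := by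
  have hmeas (t : ℕ) : Measurable fun p : P.SA => P.β ^ t * h p.1 p.2 :=
    hh.measurable.const_mul _
  have hmap (t : ℕ) : ∫ p, P.β ^ t * h p.1 p.2 ∂P.law x π t =
      ∫ ω, P.β ^ t * h (ω t).1 (ω t).2 ∂P.pathMeasure (Measure.dirac x) π :=
    integral_map (measurable_pi_apply t).aemeasurable (hmeas t).aestronglyMeasurable
  have hmapn (t : ℕ) : ∫ p, ‖P.β ^ t * h p.1 p.2‖ ∂P.law x π t =
      ∫ ω, ‖P.β ^ t * h (ω t).1 (ω t).2‖ ∂P.pathMeasure (Measure.dirac x) π :=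
    integral_map (measurable_pi_apply t).aemeasurable (hmeas t).norm.aestronglyMeasurable
  simp only [hmap]
  refine hasSum_integral_of_summable_integral_norm (fun t => ?_) ?_
  · exact (integrable_map_measure (hmeas t).aestronglyMeasurable
      (measurable_pi_apply t).aemeasurable).1 (hh.integrable_law hw x π t)
  · refine Summable.of_nonneg_of_le (fun t => integral_nonneg fun _ => norm_nonneg _)
      (fun t => ?_) ((summable_geometric_of_lt_one hw.nonneg hw.lt_one).mul_left (M * w x))
    rw [← hmapn]
    exact hh.integral_norm_law_le hw hM x π t

/-- The total value of `h` under `π` exceeds `v` by the total discounted expected advantage. -/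
theorem hasSum_advantage (hh : WBoundedCost w M h) (hM : 0 ≤ M) (hv : WBounded w C v)
    (hw : P.ContractingWeight w γ) (x : P.State) (π : P.Policy) :
    HasSum (fun t => ∫ p, P.β ^ t * P.advantage h v p ∂P.law x π t) (P.total h x π - v x) := by
  have hvc : WBoundedCost w C fun (y : P.State) (_ : Bool) => v y :=
    ⟨hv.measurable.comp measurable_fst, fun y _ => hv.abs_le y⟩
  have hC : 0 ≤ C := hv.const_nonneg hw x
  have hnext : WBoundedCost w (C * γ) fun y a => P.β * ∫ z, v z ∂P.κ (y, a) :=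
    ⟨hv.measurable_integral.const_mul _, fun y a => hv.abs_integral_le hw (y, a)⟩
  have hb := hvc.hasSum_total hw hC x π
  have hshift (t : ℕ) : ∫ p, P.β ^ (t + 1) * v p.1 ∂P.law x π (t + 1) =
      ∫ p, P.β ^ t * (P.β * ∫ z, v z ∂P.κ p) ∂P.law x π t := by
    rw [P.integral_law_succ x π t (φ := fun y => P.β ^ (t + 1) * v y)
      (hv.measurable.const_mul _) (hvc.integrable_law hw x π (t + 1))]
    simp only [integral_const_mul, pow_succ, mul_assoc]
  have h0 : ∫ p, P.β ^ 0 * v p.1 ∂P.law x π 0 = v x := by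
    simp only [pow_zero, one_mul]
    rw [law_zero, ← integral_map (f := v) measurable_fst.aemeasurable
      hv.measurable.aestronglyMeasurable, map_fst_initLaw,
      integral_dirac' _ _ hv.measurable.stronglyMeasurable]
  -- Telescoping: by `hshift` the continuation terms form the series for the discounted total of `v`
  -- with its initial term `v x` removed.
  have hb' := (hasSum_nat_add_iff' 1).2 hb
  simp only [Finset.sum_range_one, h0, hshift] at hb'
  have := ((hh.hasSum_total hw hM x π).add hb').sub hb
  have hgoal : P.total h x π - v x =
      P.total h x π + (P.total (fun y _ => v y) x π - v x) - P.total (fun y _ => v y) x π := by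
    ring
  rw [hgoal]
  refine this.congr_fun fun t => ?_
  rw [← integral_add (hh.integrable_law hw x π t) (hnext.integrable_law hw x π t),
    ← integral_sub _ (hvc.integrable_law hw x π t)]
  · refine integral_congr_ae (Eventually.of_forall fun p => ?_)
    simp only [Project.advantage]
    ring
  · exact (hh.integrable_law hw x π t).add (hnext.integrable_law hw x π t)

theorem total_le_of_advantage_nonpos (hh : WBoundedCost w M h) (hM : 0 ≤ M)
    (hv : WBounded w C v) (hw : P.ContractingWeight w γ) (hadv : ∀ p, P.advantage h v p ≤ 0)
    (x : P.State) (π : P.Policy) : P.total h x π ≤ v x :=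
  sub_nonpos.1 <| (hasSum_advantage hh hM hv hw x π).nonpos fun t =>
    integral_nonpos fun p => mul_nonpos_of_nonneg_of_nonpos (pow_nonneg P.β_nonneg t) (hadv p)

theorem ae_law_regionPolicy (B : Set P.State) (hB : MeasurableSet B) {a : P.State → Bool}
    (ha : ∀ y, a y = true ↔ y ∈ B) (x : P.State) (t : ℕ) :
    ∀ᵐ p ∂P.law x (P.regionPolicy B hB) t, p.2 = a p.1 := by
  classical
  have hae : a = fun y => decide (y ∈ B) := by
    ext y; rw [Bool.eq_iff_iff, ha, decide_eq_true_iff]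
  have hma : Measurable a := by
    refine measurable_to_bool ?_
    convert hB
    ext y; simp [ha]
  have hrule (t : ℕ) (q) : (P.regionPolicy B hB).rule t q = Measure.dirac (a q.2) := by
    simp only [regionPolicy, hae]
    rw [Kernel.deterministic_apply]
  cases t with
  | zero =>
    rw [law_zero, P.initLaw_of_rule_eq_dirac x _ (b := a x) fun q hq => by rw [hrule, hq],
      ae_dirac_iff]
    exact measurableSet_eq_fun measurable_snd (hma.comp measurable_fst)
  | succ t => exact P.ae_law_succ_of_rule_eq_dirac x _ t hma (hrule (t + 1))

theorem hasSum_advantage_regionPolicy (hh : WBoundedCost w M h) (hM : 0 ≤ M)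
    (hv : WBounded w C v) (hw : P.ContractingWeight w γ) {B : Set P.State} (hB : MeasurableSet B)
    {a : P.State → Bool} (ha : ∀ y, a y = true ↔ y ∈ B) (x : P.State) :
    HasSum (fun t => ∫ p, P.β ^ t * P.advantage h v (p.1, a p.1) ∂P.law x (P.regionPolicy B hB) t)
      (P.total h x (P.regionPolicy B hB) - v x) := by
  refine (hasSum_advantage hh hM hv hw x (P.regionPolicy B hB)).congr_fun fun t => ?_
  refine integral_congr_ae ?_
  filter_upwards [ae_law_regionPolicy B hB ha x t] with p hp
  rw [← hp]

/-- Under a stationary rule the laws live on the graph of the rule, so only advantages of its own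
actions enter: a weighted-norm bounded solution of the policy's evaluation equation is its value. -/
theorem total_regionPolicy_eq (hh : WBoundedCost w M h) (hM : 0 ≤ M)
    (hv : WBounded w C v) (hw : P.ContractingWeight w γ) {B : Set P.State} (hB : MeasurableSet B)
    {a : P.State → Bool} (ha : ∀ y, a y = true ↔ y ∈ B)
    (hadv : ∀ y, P.advantage h v (y, a y) = 0) (x : P.State) :
    P.total h x (P.regionPolicy B hB) = v x := by
  have := hasSum_advantage_regionPolicy hh hM hv hw hB ha x
  simp only [hadv, mul_zero, integral_zero] at this
  exact sub_eq_zero.1 (this.unique hasSum_zero)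

/-- Policy improvement: `v` may be the value of a different rule. -/
theorem le_total_regionPolicy (hh : WBoundedCost w M h) (hM : 0 ≤ M)
    (hv : WBounded w C v) (hw : P.ContractingWeight w γ) {B : Set P.State} (hB : MeasurableSet B)
    {a : P.State → Bool} (ha : ∀ y, a y = true ↔ y ∈ B)
    (hadv : ∀ y, 0 ≤ P.advantage h v (y, a y)) (x : P.State) :
    v x ≤ P.total h x (P.regionPolicy B hB) :=
  sub_nonneg.1 <| (hasSum_advantage_regionPolicy hh hM hv hw hB ha x).nonneg fun t =>
    integral_nonneg fun _ => mul_nonneg (pow_nonneg P.β_nonneg t) (hadv _)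

/-- From time 1 on the advantages vanish almost surely, so only the time-0 term of the
performance-difference series survives. -/
theorem total_prependAction_regionPolicy (hh : WBoundedCost w M h) (hM : 0 ≤ M)
    (hv : WBounded w C v) (hw : P.ContractingWeight w γ) {B : Set P.State} (hB : MeasurableSet B)
    {a : P.State → Bool} (ha : ∀ y, a y = true ↔ y ∈ B)
    (hadv : ∀ y, P.advantage h v (y, a y) = 0) (b : Bool) (x : P.State) :
    P.total h x (P.prependAction b (P.regionPolicy B hB)) =
      h x b + P.β * ∫ y, v y ∂P.κ (x, b) := by
  classical
  have hae : a = fun y => decide (y ∈ B) := by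
    ext y; rw [Bool.eq_iff_iff, ha, decide_eq_true_iff]
  have hma : Measurable a := by
    refine measurable_to_bool ?_
    convert hB
    ext y; simp [ha]
  set π := P.prependAction b (P.regionPolicy B hB) with hπ
  have h0 : P.law x π 0 = Measure.dirac (x, b) := by
    rw [law_zero]
    exact P.initLaw_of_rule_eq_dirac x _ fun q _ => by
      simp only [hπ, prependAction, Kernel.const_apply]
  have hsucc (t : ℕ) : ∀ᵐ p ∂P.law x π (t + 1), p.2 = a p.1 := by
    refine P.ae_law_succ_of_rule_eq_dirac x _ t hma fun q => ?_
    simp only [hπ, prependAction, regionPolicy, hae]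
    rw [Kernel.comap_apply, Kernel.deterministic_apply]
  have hsum := hasSum_advantage hh hM hv hw x π
  have hmeas : Measurable fun p : P.SA => P.β ^ 0 * P.advantage h v p :=
    (hh.advantage hv hw).measurable.const_mul _
  have hz := hasSum_single (f := fun t => ∫ p, P.β ^ t * P.advantage h v p ∂P.law x π t) 0
    (fun t ht => by
      obtain ⟨t, rfl⟩ := Nat.exists_eq_succ_of_ne_zero ht
      refine integral_eq_zero_of_ae ?_
      filter_upwards [hsucc t] with p hp
      rw [show p = (p.1, a p.1) from Prod.ext rfl hp, hadv]
      simp)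
  rw [h0, integral_dirac' _ _ hmeas.stronglyMeasurable] at hz
  have := hsum.unique hz
  simp only [Project.advantage, pow_zero, one_mul] at this
  linarith

/-! ### Values of stationary rules as series: measurability, evaluation equation, continuity. -/

/-- Expected discounted `h`-value of the `n`-th period under the stationary decision rule `a`. -/
noncomputable def stageValue (P : Project) (h : P.State → Bool → ℝ) (a : P.State → Bool) :
    ℕ → P.State → ℝ
  | 0, x => h x (a x)
  | n + 1, x => P.β * ∫ y, stageValue P h a n y ∂P.κ (x, a x)

/-- Total expected discounted `h`-value under the stationary decision rule `a`. -/
noncomputable def ruleValue (P : Project) (h : P.State → Bool → ℝ) (a : P.State → Bool)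
    (x : P.State) : ℝ :=
  ∑' n, P.stageValue h a n x

section StationaryRule

variable {a : P.State → Bool}

/-- The parameter space `Θ` provides joint measurability in threshold and state, which the later
Fubini argument needs; `Θ = Unit` covers a single rule. -/
theorem measurable_stageValue {Θ : Type*} [MeasurableSpace Θ] (hh : WBoundedCost w M h)
    {a : Θ → P.State → Bool} (ha : Measurable fun q : Θ × P.State => a q.1 q.2) (n : ℕ) :
    Measurable fun q : Θ × P.State => P.stageValue h (a q.1) n q.2 := by
  induction n with
  | zero => exact hh.measurable.comp (measurable_snd.prodMk ha)
  | succ n ih =>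
    have hk : Measurable fun q : Θ × P.State => (q.2, a q.1 q.2) := measurable_snd.prodMk ha
    have hf : Measurable fun r : (Θ × P.State) × P.State => P.stageValue h (a r.1.1) n r.2 :=
      ih.comp ((measurable_fst.comp measurable_fst).prodMk measurable_snd)
    exact ((hf.stronglyMeasurable.integral_kernel_prod_right'
      (κ := P.κ.comap _ hk)).measurable).const_mul _

theorem measurable_ruleValue {Θ : Type*} [MeasurableSpace Θ] (hh : WBoundedCost w M h)
    {a : Θ → P.State → Bool} (ha : Measurable fun q : Θ × P.State => a q.1 q.2) :
    Measurable fun q : Θ × P.State => P.ruleValue h (a q.1) q.2 :=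
  Measurable.tsum fun n => measurable_stageValue hh ha n

theorem wBounded_stageValue (hh : WBoundedCost w M h) (hw : P.ContractingWeight w γ)
    (ha : Measurable a) (n : ℕ) : WBounded w (M * γ ^ n) (P.stageValue h a n) := by
  have hm (n : ℕ) : Measurable (P.stageValue h a n) :=
    (measurable_stageValue (Θ := Unit) (a := fun _ => a) hh (ha.comp measurable_snd) n).comp
      (measurable_const.prodMk measurable_id : Measurable fun x : P.State => ((), x))
  induction n with
  | zero => exact ⟨hm 0, fun x => by simpa [stageValue] using hh.abs_le x (a x)⟩
  | succ n ih =>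
    refine ⟨hm (n + 1), fun x => ?_⟩
    rw [pow_succ, ← mul_assoc]
    exact ih.abs_integral_le hw (x, a x)

theorem summable_stageValue (hh : WBoundedCost w M h) (hw : P.ContractingWeight w γ)
    (ha : Measurable a) (x : P.State) : Summable fun n => P.stageValue h a n x := by
  refine Summable.of_norm_bounded
    ((summable_geometric_of_lt_one hw.nonneg hw.lt_one).mul_left (M * w x)) fun n => ?_
  rw [Real.norm_eq_abs, mul_right_comm]
  exact (wBounded_stageValue hh hw ha n).abs_le x

theorem wBounded_ruleValue (hh : WBoundedCost w M h) (hw : P.ContractingWeight w γ)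
    (ha : Measurable a) : WBounded w (M * (1 - γ)⁻¹) (P.ruleValue h a) where
  measurable :=
    (measurable_ruleValue (Θ := Unit) (a := fun _ => a) hh (ha.comp measurable_snd)).comp
      (measurable_const.prodMk measurable_id : Measurable fun x : P.State => ((), x))
  abs_le x := by
    rw [mul_right_comm, ← Real.norm_eq_abs]
    refine tsum_of_norm_bounded
      ((hasSum_geometric_of_lt_one hw.nonneg hw.lt_one).mul_left (M * w x)) fun n => ?_
    rw [Real.norm_eq_abs, mul_right_comm]
    exact (wBounded_stageValue hh hw ha n).abs_le x

/-- One application of the kernel shifts the series of stages by one; the geometric bound justifies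
integrating term by term. -/
theorem advantage_ruleValue (hh : WBoundedCost w M h) (hw : P.ContractingWeight w γ)
    (hM : 0 ≤ M) (ha : Measurable a) (x : P.State) :
    P.advantage h (P.ruleValue h a) (x, a x) = 0 := by
  have hs := wBounded_stageValue hh hw ha
  have h1 : P.β * ∫ y, P.ruleValue h a y ∂P.κ (x, a x) = ∑' n, P.stageValue h a (n + 1) x := by
    rw [← integral_const_mul]
    simp only [ruleValue, ← tsum_mul_left]
    rw [← integral_tsum_of_summable_integral_norm
      (fun n => (hs n).integrable_discount hw (x, a x))]
    · simp only [integral_const_mul, stageValue]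
    · refine Summable.of_nonneg_of_le (fun n => integral_nonneg fun _ => norm_nonneg _)
        (fun n => ?_) ((summable_geometric_of_lt_one hw.nonneg hw.lt_one).mul_left (M * (γ * w x)))
      calc ∫ y, ‖P.β * P.stageValue h a n y‖ ∂P.κ (x, a x)
          ≤ ∫ y, M * γ ^ n * (P.β * w y) ∂P.κ (x, a x) := by
            refine integral_mono ((hs n).integrable_discount hw _).norm
              ((hw.integrable_discount _).const_mul _) fun y => ?_
            simp only [Real.norm_eq_abs]
            rw [abs_mul, abs_of_nonneg P.β_nonneg, mul_left_comm]
            exact mul_le_mul_of_nonneg_left ((hs n).abs_le y) P.β_nonneg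
        _ ≤ M * (γ * w x) * γ ^ n := by
            rw [integral_const_mul, mul_right_comm]
            exact mul_le_mul_of_nonneg_right (mul_le_mul_of_nonneg_left
              (hw.integral_discount_le _) hM) (pow_nonneg hw.nonneg n)
  rw [advantage, h1]
  simp only [ruleValue]
  rw [(summable_stageValue hh hw ha x).tsum_eq_zero_add]
  simp [stageValue]

theorem tendsto_discount_integral {ι : Type*} {l : Filter ι} [l.IsCountablyGenerated]
    (hw : P.ContractingWeight w γ) {u : ι → P.State → ℝ} (hu : ∀ i, WBounded w C (u i))
    (hlim : ∀ y, Tendsto (fun i => u i y) l (𝓝 (v y))) (p : P.SA) :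
    Tendsto (fun i => P.β * ∫ y, u i y ∂P.κ p) l (𝓝 (P.β * ∫ y, v y ∂P.κ p)) := by
  simp only [← integral_const_mul]
  refine tendsto_integral_filter_of_dominated_convergence
    (fun y => C * (P.β * w y)) (Eventually.of_forall fun i =>
      ((hu i).measurable.const_mul _).aestronglyMeasurable)
    (Eventually.of_forall fun i => Eventually.of_forall fun y => ?_)
    ((hw.integrable_discount _).const_mul _)
    (Eventually.of_forall fun y => (hlim y).const_mul _)
  rw [Real.norm_eq_abs, abs_mul, abs_of_nonneg P.β_nonneg, mul_left_comm]
  exact mul_le_mul_of_nonneg_left ((hu i).abs_le y) P.β_nonneg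

/-- The value of a stationary rule depends continuously on the rule, for pointwise convergence. -/
theorem tendsto_ruleValue {ι : Type*} {l : Filter ι} [l.IsCountablyGenerated]
    (hh : WBoundedCost w M h) (hw : P.ContractingWeight w γ)
    {b : ι → P.State → Bool} (hb : ∀ i, Measurable (b i))
    (hlim : ∀ y, ∀ᶠ i in l, b i y = a y) (x : P.State) :
    Tendsto (fun i => P.ruleValue h (b i) x) l (𝓝 (P.ruleValue h a x)) := by
  have hstage (n : ℕ) :
      ∀ x, Tendsto (fun i => P.stageValue h (b i) n x) l (𝓝 (P.stageValue h a n x)) := by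
    induction n with
    | zero =>
      intro x
      refine tendsto_const_nhds.congr' ?_
      filter_upwards [hlim x] with i hi
      simp [stageValue, hi]
    | succ n ih =>
      intro x
      have := tendsto_discount_integral hw (fun i => wBounded_stageValue hh hw (hb i) n) ih (x, a x)
      refine this.congr' ?_
      filter_upwards [hlim x] with i hi
      simp [stageValue, hi]
  refine tendsto_tsum_of_dominated_convergence
    ((summable_geometric_of_lt_one hw.nonneg hw.lt_one).mul_left (M * w x))
    (fun n => hstage n x) (Eventually.of_forall fun i n => ?_)
  rw [Real.norm_eq_abs, mul_right_comm]
  exact (wBounded_stageValue hh hw (hb i) n).abs_le x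

end StationaryRule

/-! ### Threshold policies and their marginal metrics. -/

/-- The decision rule that is active exactly above `z`. -/
noncomputable def thresholdRule (P : Project) (z : EReal) (y : P.State) : Bool :=
  decide (z < ((y : ℝ) : EReal))

/-- Change of the total `h`-value when the first action is active rather than passive and the
`z`-policy is used afterwards. -/
noncomputable def marginal (P : Project) (h : P.State → Bool → ℝ) (z : EReal) (x : P.State) : ℝ :=
  h x true - h x false + (P.β * ∫ y, P.ruleValue h (P.thresholdRule z) y ∂P.κ (x, true) -
    P.β * ∫ y, P.ruleValue h (P.thresholdRule z) y ∂P.κ (x, false))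

theorem thresholdRule_eq_true {z : EReal} {y : P.State} :
    P.thresholdRule z y = true ↔ z < ((y : ℝ) : EReal) := by
  simp [thresholdRule]

theorem thresholdRule_eq_false {z : EReal} {y : P.State} :
    P.thresholdRule z y = false ↔ ((y : ℝ) : EReal) ≤ z := by
  simp [thresholdRule]

theorem measurable_thresholdRule_uncurry :
    Measurable fun q : EReal × P.State => P.thresholdRule q.1 q.2 := by
  refine measurable_to_bool ?_
  have : MeasurableSet {q : EReal × P.State | q.1 < ((q.2 : ℝ) : EReal)} :=
    measurableSet_lt measurable_fst
      (measurable_coe_real_ereal.comp (measurable_subtype_coe.comp measurable_snd))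
  convert this
  ext q; simp [thresholdRule]

theorem measurable_thresholdRule (z : EReal) : Measurable (P.thresholdRule z) :=
  measurable_thresholdRule_uncurry.comp (measurable_const.prodMk measurable_id)

theorem total_zPolicy (hh : WBoundedCost w M h) (hM : 0 ≤ M) (hw : P.ContractingWeight w γ)
    (z : EReal) (x : P.State) :
    P.total h x (P.zPolicy z) = P.ruleValue h (P.thresholdRule z) x :=
  total_regionPolicy_eq hh hM (wBounded_ruleValue hh hw (measurable_thresholdRule z)) hw _
    (fun _ => thresholdRule_eq_true)
    (advantage_ruleValue hh hw hM (measurable_thresholdRule z)) x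

theorem marginal_eq (hh : WBoundedCost w M h) (hM : 0 ≤ M) (hw : P.ContractingWeight w γ)
    (z : EReal) (x : P.State) :
    P.total h x (P.prependAction true (P.zPolicy z)) -
      P.total h x (P.prependAction false (P.zPolicy z)) = P.marginal h z x := by
  have key (b : Bool) : P.total h x (P.prependAction b (P.zPolicy z)) =
      h x b + P.β * ∫ y, P.ruleValue h (P.thresholdRule z) y ∂P.κ (x, b) :=
    total_prependAction_regionPolicy hh hM
      (wBounded_ruleValue hh hw (measurable_thresholdRule z)) hw _
      (fun _ => thresholdRule_eq_true)
      (advantage_ruleValue hh hw hM (measurable_thresholdRule z)) b x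
  rw [key, key, marginal]
  ring

theorem advantage_true_sub_false (z : EReal) (x : P.State) :
    P.advantage h (P.ruleValue h (P.thresholdRule z)) (x, true) -
      P.advantage h (P.ruleValue h (P.thresholdRule z)) (x, false) = P.marginal h z x := by
  simp only [advantage, marginal]
  ring

theorem tendsto_marginal {ι : Type*} {l : Filter ι} [l.IsCountablyGenerated]
    (hh : WBoundedCost w M h) (hw : P.ContractingWeight w γ) {b : ι → EReal} {z : EReal}
    (hlim : ∀ y, ∀ᶠ i in l, P.thresholdRule (b i) y = P.thresholdRule z y) (x : P.State) :
    Tendsto (fun i => P.marginal h (b i) x) l (𝓝 (P.marginal h z x)) := by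
  have (p : P.SA) := tendsto_discount_integral hw
    (fun i => wBounded_ruleValue hh hw (measurable_thresholdRule (b i)))
    (tendsto_ruleValue hh hw (fun i => measurable_thresholdRule (b i)) hlim) p
  exact ((this (x, true)).sub (this (x, false))).const_add _

/-- Each fixed state is passive once the threshold has passed it, which is its action under `⊤`.
Pointwise agreement suffices, by dominated convergence. -/
theorem tendsto_marginal_atTop (hh : WBoundedCost w M h) (hw : P.ContractingWeight w γ)
    (x : P.State) : Tendsto (fun t : ℝ => P.marginal h t x) atTop (𝓝 (P.marginal h ⊤ x)) := by
  refine tendsto_marginal hh hw (fun y => ?_) x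
  filter_upwards [eventually_ge_atTop (y : ℝ)] with t ht
  rw [thresholdRule_eq_false.2 (by exact_mod_cast ht), thresholdRule_eq_false.2 le_top]

theorem tendsto_marginal_atBot (hh : WBoundedCost w M h) (hw : P.ContractingWeight w γ)
    (x : P.State) : Tendsto (fun t : ℝ => P.marginal h t x) atBot (𝓝 (P.marginal h ⊥ x)) := by
  refine tendsto_marginal hh hw (fun y => ?_) x
  filter_upwards [eventually_lt_atBot (y : ℝ)] with t ht
  rw [thresholdRule_eq_true.2 (by exact_mod_cast ht),
    thresholdRule_eq_true.2 (EReal.bot_lt_coe _)]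

/-- Activity means strictly above the threshold. As s decreases to t, a state at or below t stays
passive and a state above t eventually becomes active. -/
theorem continuousWithinAt_ruleValue (hh : WBoundedCost w M h) (hw : P.ContractingWeight w γ)
    (x : P.State) (t : ℝ) :
    ContinuousWithinAt (fun s : ℝ => P.ruleValue h (P.thresholdRule s) x) (Ici t) t := by
  refine tendsto_ruleValue hh hw (fun s => measurable_thresholdRule _) (fun y => ?_) x
  by_cases hy : t < (y : ℝ)
  · filter_upwards [mem_nhdsWithin_of_mem_nhds (Iio_mem_nhds hy)] with s hs
    rw [thresholdRule_eq_true.2 (by exact_mod_cast hs),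
      thresholdRule_eq_true.2 (by exact_mod_cast hy)]
  · filter_upwards [self_mem_nhdsWithin] with s hs
    rw [thresholdRule_eq_false.2 (by exact_mod_cast (not_lt.1 hy).trans hs),
      thresholdRule_eq_false.2 (by exact_mod_cast not_lt.1 hy)]

/-- The two rules differ only for states in (z₁, z₂], where the `z₁`-policy is active. Against the
value of the `z₂`-policy its advantage there is the positive marginal, so policy improvement
applies. -/
theorem antitone_ruleValue (hh : WBoundedCost w M h) (hM : 0 ≤ M) (hw : P.ContractingWeight w γ)
    (hpos : ∀ (x : P.State) (z : EReal), 0 < P.marginal h z x) (x : P.State) :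
    Antitone fun z : EReal => P.ruleValue h (P.thresholdRule z) x := by
  intro z₁ z₂ hz
  simp only
  rw [← total_zPolicy hh hM hw z₁]
  refine le_total_regionPolicy hh hM (wBounded_ruleValue hh hw (measurable_thresholdRule z₂)) hw _
    (fun _ => thresholdRule_eq_true) (fun y => ?_) x
  have h2 := advantage_ruleValue hh hw hM (measurable_thresholdRule z₂) y
  by_cases h12 : P.thresholdRule z₁ y = P.thresholdRule z₂ y
  · rw [h12, h2]
  · have hy2 : P.thresholdRule z₂ y = false := by
      by_contra hc
      rw [Bool.not_eq_false] at hc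
      exact h12 ((thresholdRule_eq_true.2 (hz.trans_lt (thresholdRule_eq_true.1 hc))).trans hc.symm)
    have hy1 : P.thresholdRule z₁ y = true := by
      rw [hy2] at h12
      exact Bool.not_eq_false _ ▸ h12
    rw [hy2] at h2
    rw [hy1]
    linarith [advantage_true_sub_false (h := h) z₂ y, hpos y z₂]

theorem measurable_integral_ruleValue (hh : WBoundedCost w M h) (p : P.SA) :
    Measurable fun t : ℝ => ∫ y, P.ruleValue h (P.thresholdRule t) y ∂P.κ p := by
  have hm : Measurable fun q : ℝ × P.State => P.ruleValue h (P.thresholdRule q.1) q.2 :=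
    measurable_ruleValue (a := fun t : ℝ => P.thresholdRule t) hh
      (measurable_thresholdRule_uncurry.comp
        ((measurable_coe_real_ereal.comp measurable_fst).prodMk measurable_snd))
  exact (hm.stronglyMeasurable.integral_prod_right' (ν := P.κ p)).measurable

theorem abs_discount_integral_ruleValue_le (hh : WBoundedCost w M h)
    (hw : P.ContractingWeight w γ) (z : EReal) (p : P.SA) :
    |P.β * ∫ y, P.ruleValue h (P.thresholdRule z) y ∂P.κ p| ≤ M * (1 - γ)⁻¹ * γ * w p.1 :=
  (wBounded_ruleValue hh hw (measurable_thresholdRule z)).abs_integral_le hw p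

/-! ### The extension of the index to the real line. -/

section Clamp

theorem coe_clamp (P : Project) (z : ℝ) :
    (((P.clamp z : P.State) : ℝ) : EReal) = max P.l (min (z : EReal) P.u) := by
  refine EReal.coe_toReal ?_ ?_
  · exact (max_lt (lt_of_lt_of_le P.l_lt_u le_top)
      (lt_of_le_of_lt (min_le_left _ _) (EReal.coe_lt_top z))).ne
  · exact (lt_of_lt_of_le (lt_min (EReal.bot_lt_coe z) (lt_of_le_of_lt bot_le P.l_lt_u))
      (le_max_right _ _)).ne'

theorem monotone_clamp (P : Project) : Monotone P.clamp := by
  intro a b hab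
  rw [← Subtype.coe_le_coe, ← EReal.coe_le_coe_iff, coe_clamp, coe_clamp]
  exact max_le_max le_rfl (min_le_min (by exact_mod_cast hab) le_rfl)

theorem continuous_clamp (P : Project) : Continuous P.clamp := by
  have h : Continuous fun z : ℝ => (((P.clamp z : P.State) : ℝ) : EReal) := by
    simp only [coe_clamp]
    exact continuous_const.max (continuous_coe_real_ereal.min continuous_const)
  exact continuous_induced_rng.2 (EReal.isEmbedding_coe.continuous_iff.2 h)

theorem clamp_coe (P : Project) (x : P.State) : P.clamp x = x := by
  refine Subtype.ext ?_
  rw [← EReal.coe_eq_coe_iff, coe_clamp, min_eq_left x.2.2, max_eq_right x.2.1]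

theorem mpIndexExt_coe (P : Project) (x : P.State) : P.mpIndexExt x = P.mpIndex x := by
  rw [mpIndexExt, clamp_coe]

end Clamp

/-! ### Transfer of (PCLI3) to the marginal metrics. -/

/-- The measure `dm*` induced by the extended index. -/
noncomputable def indexMeasure (P : Project) (hJ : Monotone P.mpIndexExt)
    (hJc : Continuous P.mpIndexExt) : Measure ℝ :=
  (contStieltjes P.mpIndexExt hJ hJc).measure

theorem indexMeasure_Ioc (hJ : Monotone P.mpIndexExt) (hJc : Continuous P.mpIndexExt) (a b : ℝ) :
    P.indexMeasure hJ hJc (Ioc a b) = ENNReal.ofReal (P.mpIndexExt b - P.mpIndexExt a) :=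
  StieltjesFunction.measure_Ioc _ _ _

theorem indexMeasure_real_Ioc (hJ : Monotone P.mpIndexExt) (hJc : Continuous P.mpIndexExt)
    {a b : ℝ} (hab : a ≤ b) :
    (P.indexMeasure hJ hJc).real (Ioc a b) = P.mpIndexExt b - P.mpIndexExt a := by
  rw [measureReal_def, indexMeasure_Ioc, ENNReal.toReal_ofReal (sub_nonneg.2 (hJ hab))]

/-- Integration by parts replaces the state-dependent integrator G(y,·) by the fixed measure dm,
leaving an identity linear in the values, which can be integrated over `y`. -/
theorem ruleValue_by_parts (hr : WBoundedCost w M P.r) (hc : WBoundedCost w M P.c) (hM : 0 ≤ M)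
    (hw : P.ContractingWeight w γ) (hg : ∀ (x : P.State) (z : EReal), 0 < P.marginal P.c z x)
    (hJ : Monotone P.mpIndexExt) (hJc : Continuous P.mpIndexExt) (h3 : P.PCLI3)
    {a b : ℝ} (hab : a < b) (y : P.State) :
    P.ruleValue P.r (P.thresholdRule b) y - P.ruleValue P.r (P.thresholdRule a) y =
      P.mpIndexExt b * P.ruleValue P.c (P.thresholdRule b) y -
        P.mpIndexExt a * P.ruleValue P.c (P.thresholdRule a) y -
        ∫ t in Ioc a b, P.ruleValue P.c (P.thresholdRule t) y ∂P.indexMeasure hJ hJc := by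
  have h := h3 y a b hab
  have hF (z : EReal) : P.F y (P.zPolicy z) = P.ruleValue P.r (P.thresholdRule z) y :=
    total_zPolicy hr hM hw z y
  have hG (z : EReal) : P.G y (P.zPolicy z) = P.ruleValue P.c (P.thresholdRule z) y :=
    total_zPolicy hc hM hw z y
  simp only [hF, hG] at h
  rw [h]
  exact lsIntegral_Ioc_by_parts
    (fun s t hst => antitone_ruleValue hc hM hw hg y (by exact_mod_cast hst))
    (fun t => (wBounded_ruleValue hc hw (measurable_thresholdRule t)).abs_le y)
    (continuousWithinAt_ruleValue hc hw y) hJ hJc hab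

theorem discount_integral_by_parts (hr : WBoundedCost w M P.r) (hc : WBoundedCost w M P.c)
    (hM : 0 ≤ M) (hw : P.ContractingWeight w γ)
    (hg : ∀ (x : P.State) (z : EReal), 0 < P.marginal P.c z x)
    (hJ : Monotone P.mpIndexExt) (hJc : Continuous P.mpIndexExt) (h3 : P.PCLI3)
    {a b : ℝ} (hab : a < b) (p : P.SA) :
    P.β * ∫ y, P.ruleValue P.r (P.thresholdRule b) y ∂P.κ p -
        P.β * ∫ y, P.ruleValue P.r (P.thresholdRule a) y ∂P.κ p =
      P.mpIndexExt b * (P.β * ∫ y, P.ruleValue P.c (P.thresholdRule b) y ∂P.κ p) -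
        P.mpIndexExt a * (P.β * ∫ y, P.ruleValue P.c (P.thresholdRule a) y ∂P.κ p) -
        ∫ t in Ioc a b, P.β * ∫ y, P.ruleValue P.c (P.thresholdRule t) y ∂P.κ p
          ∂P.indexMeasure hJ hJc := by
  set m := P.indexMeasure hJ hJc with hm
  have : IsFiniteMeasure (m.restrict (Ioc a b)) := ⟨by simp [hm, indexMeasure_Ioc]⟩
  have hv (z : EReal) := wBounded_ruleValue hc hw (measurable_thresholdRule (P := P) z)
  have hvr (z : EReal) := wBounded_ruleValue hr hw (measurable_thresholdRule (P := P) z)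
  have hmeas : Measurable fun q : P.State × ℝ => P.ruleValue P.c (P.thresholdRule q.2) q.1 :=
    (measurable_ruleValue (a := fun t : ℝ => P.thresholdRule t) hc
      (measurable_thresholdRule_uncurry.comp
        ((measurable_coe_real_ereal.comp measurable_fst).prodMk measurable_snd))).comp
      measurable_swap
  have hint : Integrable (Function.uncurry fun (y : P.State) (t : ℝ) =>
      P.β * P.ruleValue P.c (P.thresholdRule t) y) ((P.κ p).prod (m.restrict (Ioc a b))) := by
    refine Integrable.mono' (((hw.integrable_discount p).const_mul (M * (1 - γ)⁻¹)).comp_fst _)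
      (hmeas.const_mul _).aestronglyMeasurable (Eventually.of_forall fun q => ?_)
    simp only [Function.uncurry_def]
    rw [Real.norm_eq_abs, abs_mul, abs_of_nonneg P.β_nonneg, mul_left_comm]
    exact mul_le_mul_of_nonneg_left ((hv _).abs_le _) P.β_nonneg
  have hswap := integral_integral_swap hint
  simp only [integral_const_mul] at hswap
  simp only [← integral_const_mul (P.β)] at hswap ⊢
  rw [← hswap, ← integral_const_mul, ← integral_const_mul,
    ← integral_sub ((hvr _).integrable_discount hw p) ((hvr _).integrable_discount hw p),
    ← integral_sub (((hv _).integrable_discount hw p).const_mul _)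
      (((hv _).integrable_discount hw p).const_mul _), ← integral_sub]
  · refine integral_congr_ae (Eventually.of_forall fun y => ?_)
    simp only [integral_const_mul]
    linear_combination P.β * ruleValue_by_parts hr hc hM hw hg hJ hJc h3 hab y
  · exact (((hv _).integrable_discount hw p).const_mul _).sub
      (((hv _).integrable_discount hw p).const_mul _)
  · exact hint.integral_prod_left

theorem integrableOn_discount_integral (hc : WBoundedCost w M P.c)
    (hw : P.ContractingWeight w γ) (hJ : Monotone P.mpIndexExt) (hJc : Continuous P.mpIndexExt)
    (a b : ℝ) (p : P.SA) :
    IntegrableOn (fun t : ℝ => P.β * ∫ y, P.ruleValue P.c (P.thresholdRule t) y ∂P.κ p)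
      (Ioc a b) (P.indexMeasure hJ hJc) :=
  Measure.integrableOn_of_bounded (M := M * (1 - γ)⁻¹ * γ * w p.1) (by simp [indexMeasure_Ioc])
    ((measurable_integral_ruleValue hc p).const_mul _).aestronglyMeasurable
    (Eventually.of_forall fun t => abs_discount_integral_ruleValue_le hc hw t p)

theorem integrableOn_const_indexMeasure (hJ : Monotone P.mpIndexExt)
    (hJc : Continuous P.mpIndexExt) (a b k : ℝ) :
    IntegrableOn (fun _ => k) (Ioc a b) (P.indexMeasure hJ hJc) :=
  integrableOn_const (by simp [indexMeasure_Ioc])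

theorem integrableOn_marginal (hc : WBoundedCost w M P.c)
    (hw : P.ContractingWeight w γ) (hJ : Monotone P.mpIndexExt) (hJc : Continuous P.mpIndexExt)
    (a b : ℝ) (x : P.State) :
    IntegrableOn (fun t : ℝ => P.marginal P.c t x) (Ioc a b) (P.indexMeasure hJ hJc) :=
  (integrableOn_const_indexMeasure hJ hJc a b _).add
    ((integrableOn_discount_integral hc hw hJ hJc a b _).sub
      (integrableOn_discount_integral hc hw hJ hJc a b _))

/-- Difference of the averaged identities for the two actions. The one-period terms do not depend on
the threshold: the reward part cancels on the left, and the resource part cancels against its share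
of the integral. -/
theorem marginal_by_parts (hr : WBoundedCost w M P.r) (hc : WBoundedCost w M P.c)
    (hM : 0 ≤ M) (hw : P.ContractingWeight w γ)
    (hg : ∀ (x : P.State) (z : EReal), 0 < P.marginal P.c z x)
    (hJ : Monotone P.mpIndexExt) (hJc : Continuous P.mpIndexExt) (h3 : P.PCLI3)
    {a b : ℝ} (hab : a ≤ b) (x : P.State) :
    P.marginal P.r b x - P.marginal P.r a x =
      P.mpIndexExt b * P.marginal P.c b x - P.mpIndexExt a * P.marginal P.c a x -
        ∫ t in Ioc a b, P.marginal P.c t x ∂P.indexMeasure hJ hJc := by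
  rcases hab.eq_or_lt with rfl | hab
  · simp
  have h1 := discount_integral_by_parts hr hc hM hw hg hJ hJc h3 hab (x, true)
  have h0 := discount_integral_by_parts hr hc hM hw hg hJ hJc h3 hab (x, false)
  have hi (e : Bool) := integrableOn_discount_integral hc hw hJ hJc a b (x, e)
  have hI : ∫ t in Ioc a b, P.marginal P.c t x ∂P.indexMeasure hJ hJc =
      (P.mpIndexExt b - P.mpIndexExt a) * (P.c x true - P.c x false) +
      ((∫ t in Ioc a b, P.β * ∫ y, P.ruleValue P.c (P.thresholdRule t) y ∂P.κ (x, true)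
          ∂P.indexMeasure hJ hJc) -
        ∫ t in Ioc a b, P.β * ∫ y, P.ruleValue P.c (P.thresholdRule t) y ∂P.κ (x, false)
          ∂P.indexMeasure hJ hJc) := by
    have hsub : IntegrableOn (fun t : ℝ =>
        P.β * ∫ y, P.ruleValue P.c (P.thresholdRule t) y ∂P.κ (x, true) -
        P.β * ∫ y, P.ruleValue P.c (P.thresholdRule t) y ∂P.κ (x, false))
        (Ioc a b) (P.indexMeasure hJ hJc) := (hi true).sub (hi false)
    simp only [marginal]
    rw [integral_add (integrableOn_const_indexMeasure hJ hJc a b _) hsub,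
      integral_sub (hi true) (hi false), setIntegral_const, indexMeasure_real_Ioc hJ hJc hab.le,
      smul_eq_mul]
  rw [hI]
  simp only [marginal]
  linear_combination h1 - h0

theorem integral_marginal_nonneg (hg : ∀ (x : P.State) (z : EReal), 0 < P.marginal P.c z x)
    (hJ : Monotone P.mpIndexExt) (hJc : Continuous P.mpIndexExt) (a b : ℝ) (x : P.State) :
    0 ≤ ∫ t in Ioc a b, P.marginal P.c t x ∂P.indexMeasure hJ hJc :=
  integral_nonneg fun t => (hg x t).le

/-- The integrand is positive everywhere, so the integral vanishes only when the interval has no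
dm-mass. This is the source of the exact equivalences in indexability. -/
theorem integral_marginal_pos_iff (hc : WBoundedCost w M P.c) (hw : P.ContractingWeight w γ)
    (hg : ∀ (x : P.State) (z : EReal), 0 < P.marginal P.c z x)
    (hJ : Monotone P.mpIndexExt) (hJc : Continuous P.mpIndexExt) (a b : ℝ) (x : P.State) :
    0 < ∫ t in Ioc a b, P.marginal P.c t x ∂P.indexMeasure hJ hJc ↔
      P.mpIndexExt a < P.mpIndexExt b := by
  have hsupp : Function.support (fun t : ℝ => P.marginal P.c t x) = univ :=
    eq_univ_of_forall fun t => (hg x t).ne'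
  rw [setIntegral_pos_iff_support_of_nonneg_ae (Eventually.of_forall fun t : ℝ => (hg x t).le)
    (integrableOn_marginal hc hw hJ hJc a b x), hsupp, univ_inter, indexMeasure_Ioc,
    ENNReal.ofReal_pos, sub_pos]

theorem marginal_reward_self (hr : WBoundedCost w M P.r) (hc : WBoundedCost w M P.c)
    (hM : 0 ≤ M) (hw : P.ContractingWeight w γ)
    (hg : ∀ (x : P.State) (z : EReal), 0 < P.marginal P.c z x) (x : P.State) :
    P.marginal P.r (x : ℝ) x = P.mpIndexExt x * P.marginal P.c (x : ℝ) x := by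
  have hf : P.f x (P.zPolicy (x : ℝ)) = P.marginal P.r (x : ℝ) x := marginal_eq hr hM hw _ x
  have hgx : P.g x (P.zPolicy (x : ℝ)) = P.marginal P.c (x : ℝ) x := marginal_eq hc hM hw _ x
  rw [mpIndexExt_coe, mpIndex, hf, hgx, div_mul_cancel₀ _ (hg x _).ne']

/-- The net marginal value under the `z`-policy, for a threshold `z` to the right of the state. -/
theorem marginal_sub_of_le (hr : WBoundedCost w M P.r) (hc : WBoundedCost w M P.c)
    (hM : 0 ≤ M) (hw : P.ContractingWeight w γ)
    (hg : ∀ (x : P.State) (z : EReal), 0 < P.marginal P.c z x)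
    (hJ : Monotone P.mpIndexExt) (hJc : Continuous P.mpIndexExt) (h3 : P.PCLI3)
    {x : P.State} {z : ℝ} (hz : (x : ℝ) ≤ z) (lam : ℝ) :
    P.marginal P.r z x - lam * P.marginal P.c z x =
      (P.mpIndexExt z - lam) * P.marginal P.c z x -
        ∫ t in Ioc (x : ℝ) z, P.marginal P.c t x ∂P.indexMeasure hJ hJc := by
  linear_combination marginal_by_parts hr hc hM hw hg hJ hJc h3 hz x +
    marginal_reward_self hr hc hM hw hg x

/-- The net marginal value under the `z`-policy, for a threshold `z` to the left of the state. -/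
theorem marginal_sub_of_ge (hr : WBoundedCost w M P.r) (hc : WBoundedCost w M P.c)
    (hM : 0 ≤ M) (hw : P.ContractingWeight w γ)
    (hg : ∀ (x : P.State) (z : EReal), 0 < P.marginal P.c z x)
    (hJ : Monotone P.mpIndexExt) (hJc : Continuous P.mpIndexExt) (h3 : P.PCLI3)
    {x : P.State} {z : ℝ} (hz : z ≤ (x : ℝ)) (lam : ℝ) :
    P.marginal P.r z x - lam * P.marginal P.c z x =
      (P.mpIndexExt z - lam) * P.marginal P.c z x +
        ∫ t in Ioc z (x : ℝ), P.marginal P.c t x ∂P.indexMeasure hJ hJc := by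
  linear_combination -marginal_by_parts hr hc hM hw hg hJ hJc h3 hz x +
    marginal_reward_self hr hc hM hw hg x

/-- For every price there is a threshold that separates the states by their index, and the net
marginal value under its policy has the sign of the index minus the price. -/
theorem exists_threshold (hr : WBoundedCost w M P.r) (hc : WBoundedCost w M P.c)
    (hM : 0 ≤ M) (hw : P.ContractingWeight w γ)
    (hg : ∀ (x : P.State) (z : EReal), 0 < P.marginal P.c z x)
    (hJ : Monotone P.mpIndexExt) (hJc : Continuous P.mpIndexExt) (h3 : P.PCLI3) (lam : ℝ) :
    ∃ z : EReal, (∀ x : P.State, z ≤ ((x : ℝ) : EReal) → lam ≤ P.mpIndexExt x) ∧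
      (∀ x : P.State, ((x : ℝ) : EReal) ≤ z → P.mpIndexExt x ≤ lam) ∧
      ∀ x : P.State,
        (0 ≤ P.marginal P.r z x - lam * P.marginal P.c z x ↔ lam ≤ P.mpIndexExt x) ∧
        (P.marginal P.r z x - lam * P.marginal P.c z x ≤ 0 ↔ P.mpIndexExt x ≤ lam) := by
  by_cases hex : ∃ z : ℝ, P.mpIndexExt z = lam
  · obtain ⟨z, rfl⟩ := hex
    refine ⟨z, fun x hx => hJ (by exact_mod_cast hx), fun x hx => hJ (by exact_mod_cast hx),
      fun x => ?_⟩
    rcases le_total (x : ℝ) z with hz | hz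
    · rw [marginal_sub_of_le hr hc hM hw hg hJ hJc h3 hz]
      have h0 := integral_marginal_nonneg hg hJ hJc (x : ℝ) z x
      have h1 := integral_marginal_pos_iff hc hw hg hJ hJc (x : ℝ) z x
      have h2 := hJ hz
      simp only [sub_self, zero_mul, zero_sub, neg_nonneg, neg_nonpos, h0, h2, and_true]
      rw [← not_lt, h1, not_lt]
    · rw [marginal_sub_of_ge hr hc hM hw hg hJ hJc h3 hz]
      have h0 := integral_marginal_nonneg hg hJ hJc z (x : ℝ) x
      have h1 := integral_marginal_pos_iff hc hw hg hJ hJc z (x : ℝ) x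
      have h2 := hJ hz
      simp only [sub_self, zero_mul, zero_add, h0, h2, true_and]
      rw [← not_lt, h1, not_lt]
  -- By the intermediate value theorem, an index that misses the price stays on one side of it.
  · have hside : (∀ t, P.mpIndexExt t < lam) ∨ ∀ t, lam < P.mpIndexExt t := by
      by_contra! hcon
      obtain ⟨⟨s, hs⟩, t, ht⟩ := hcon
      exact hex (mem_range_of_exists_le_of_exists_ge hJc ⟨t, ht⟩ ⟨s, hs⟩)
    rcases hside with hlt | hgt
    · have hneg (x : P.State) : P.marginal P.r ⊤ x - lam * P.marginal P.c ⊤ x < 0 := by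
        have hlim := (tendsto_marginal_atTop hr hw x).sub
          ((tendsto_marginal_atTop hc hw x).const_mul lam)
        -- A limit of negative numbers may be zero, so a bound away from zero is needed. If the
        -- index rises to the right of `x`, the fixed integral over (x,N] supplies it; if it is
        -- constant there, the bound is the index minus the price times g(x,t), whose limit is
        -- negative because g(x,∞) > 0.
        by_cases hN : ∃ N, (x : ℝ) ≤ N ∧ P.mpIndexExt x < P.mpIndexExt N
        · obtain ⟨N, hxN, hN⟩ := hN
          have hpos := (integral_marginal_pos_iff hc hw hg hJ hJc (x : ℝ) N x).2 hN
          refine (le_of_tendsto hlim ?_).trans_lt (neg_neg_of_pos hpos)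
          filter_upwards [eventually_ge_atTop N] with t ht
          rw [marginal_sub_of_le hr hc hM hw hg hJ hJc h3 (hxN.trans ht)]
          have h1 : (P.mpIndexExt t - lam) * P.marginal P.c t x ≤ 0 :=
            mul_nonpos_of_nonpos_of_nonneg (sub_nonpos.2 (hlt t).le) (hg x t).le
          have h2 := setIntegral_mono_set (integrableOn_marginal hc hw hJ hJc (x : ℝ) t x)
            (Eventually.of_forall fun s => (hg x s).le)
            (Ioc_subset_Ioc_right ht).eventuallyLE
          linarith
        · push Not at hN
          refine (le_of_tendsto_of_tendsto hlim ((tendsto_marginal_atTop hc hw x).const_mul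
            (P.mpIndexExt x - lam)) ?_).trans_lt
            (mul_neg_of_neg_of_pos (sub_neg.2 (hlt x)) (hg x ⊤))
          filter_upwards [eventually_ge_atTop (x : ℝ)] with t ht
          rw [marginal_sub_of_le hr hc hM hw hg hJ hJc h3 ht, le_antisymm (hN t ht) (hJ ht)]
          linarith [integral_marginal_nonneg hg hJ hJc (x : ℝ) t x]
      exact ⟨⊤, fun x hx => absurd (top_le_iff.1 hx) (EReal.coe_ne_top _), fun x _ => (hlt x).le,
        fun x => ⟨iff_of_false (hneg x).not_ge (hlt x).not_ge,
          iff_of_true (hneg x).le (hlt x).le⟩⟩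
    · have hpos (x : P.State) : 0 < P.marginal P.r ⊥ x - lam * P.marginal P.c ⊥ x := by
        have hlim := (tendsto_marginal_atBot hr hw x).sub
          ((tendsto_marginal_atBot hc hw x).const_mul lam)
        -- Mirror image to the left of `x`.
        by_cases hN : ∃ N, N ≤ (x : ℝ) ∧ P.mpIndexExt N < P.mpIndexExt x
        · obtain ⟨N, hxN, hN⟩ := hN
          have hpos := (integral_marginal_pos_iff hc hw hg hJ hJc N (x : ℝ) x).2 hN
          refine hpos.trans_le (ge_of_tendsto hlim ?_)
          filter_upwards [eventually_le_atBot N] with t ht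
          rw [marginal_sub_of_ge hr hc hM hw hg hJ hJc h3 (ht.trans hxN)]
          have h1 : 0 ≤ (P.mpIndexExt t - lam) * P.marginal P.c t x :=
            mul_nonneg (sub_nonneg.2 (hgt t).le) (hg x t).le
          have h2 := setIntegral_mono_set (integrableOn_marginal hc hw hJ hJc t (x : ℝ) x)
            (Eventually.of_forall fun s => (hg x s).le)
            (Ioc_subset_Ioc_left ht).eventuallyLE
          linarith
        · push Not at hN
          refine (mul_pos (sub_pos.2 (hgt x)) (hg x ⊥)).trans_le
            (le_of_tendsto_of_tendsto ((tendsto_marginal_atBot hc hw x).const_mul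
            (P.mpIndexExt x - lam)) hlim ?_)
          filter_upwards [eventually_le_atBot (x : ℝ)] with t ht
          rw [marginal_sub_of_ge hr hc hM hw hg hJ hJc h3 ht, le_antisymm (hJ ht) (hN t ht)]
          linarith [integral_marginal_nonneg hg hJ hJc t (x : ℝ) x]
      exact ⟨⊥, fun x _ => (hgt x).le, fun x hx => absurd (le_bot_iff.1 hx) (EReal.coe_ne_bot _),
        fun x => ⟨iff_of_true (hpos x).le (hgt x).le,
          iff_of_false (hpos x).not_ge (hgt x).not_ge⟩⟩

/-! ### The priced problem: verification of optimality. -/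

section NetCost

/-- One-period net reward at resource price `lam`. -/
def netReward (P : Project) (lam : ℝ) (x : P.State) (a : Bool) : ℝ := P.r x a - lam * P.c x a

theorem wBoundedCost_netReward (hr : WBoundedCost w M P.r) (hc : WBoundedCost w M P.c) (lam : ℝ) :
    WBoundedCost w (M + |lam| * M) (P.netReward lam) where
  measurable := hr.measurable.sub (hc.measurable.const_mul lam)
  abs_le x a := by
    have h1 : |lam * P.c x a| ≤ |lam| * (M * w x) := by
      rw [abs_mul]
      exact mul_le_mul_of_nonneg_left (hc.abs_le x a) (abs_nonneg _)
    rw [netReward]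
    linarith [abs_sub (P.r x a) (lam * P.c x a), hr.abs_le x a]

theorem V_eq_total (hr : WBoundedCost w M P.r) (hc : WBoundedCost w M P.c) (hM : 0 ≤ M)
    (hw : P.ContractingWeight w γ) (lam : ℝ) (x : P.State) (π : P.Policy) :
    P.V lam x π = P.total (P.netReward lam) x π := by
  have h1 := (hr.hasSum_total hw hM x π).sub ((hc.hasSum_total hw hM x π).mul_left lam)
  have h2 := (wBoundedCost_netReward hr hc lam).hasSum_total hw
    (add_nonneg hM (mul_nonneg (abs_nonneg lam) hM)) x π
  refine (h1.congr_fun fun t => ?_).unique h2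
  rw [← integral_const_mul, ← integral_sub (hr.integrable_law hw x π t)
    ((hc.integrable_law hw x π t).const_mul lam)]
  refine integral_congr_ae (Eventually.of_forall fun p => ?_)
  simp only [netReward]
  ring

theorem advantage_netReward {C C' : ℝ} {vr vc : P.State → ℝ} (hvr : WBounded w C vr)
    (hvc : WBounded w C' vc) (hw : P.ContractingWeight w γ) (lam : ℝ) (p : P.SA) :
    P.advantage (P.netReward lam) (fun y => vr y - lam * vc y) p =
      P.advantage P.r vr p - lam * P.advantage P.c vc p := by
  have : P.β * ∫ y, (vr y - lam * vc y) ∂P.κ p =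
      P.β * ∫ y, vr y ∂P.κ p - lam * (P.β * ∫ y, vc y ∂P.κ p) := by
    simp only [← integral_const_mul P.β]
    rw [← integral_const_mul, ← integral_sub (hvr.integrable_discount hw p)
      ((hvc.integrable_discount hw p).const_mul lam)]
    refine integral_congr_ae (Eventually.of_forall fun y => ?_)
    ring
  simp only [advantage, netReward, this]
  ring

end NetCost

theorem WeightedNormAssumption.exists_contractingWeight (hP : P.WeightedNormAssumption) :
    ∃ (w : P.State → ℝ) (M γ : ℝ), 0 ≤ M ∧ P.ContractingWeight w γ ∧ WBoundedCost w M P.r ∧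
      WBoundedCost w M P.c := by
  obtain ⟨hr, hc, hc0, w, M, γ, hwm, hw1, hM, hβγ, hγ, hb, hl⟩ := hP
  refine ⟨w, M, γ, hM.le, ⟨hwm, hw1, P.β_nonneg.trans hβγ, hγ, fun p => hl p.1 p.2⟩,
    ⟨measurable_from_prod_countable_left fun a => (hr a).measurable, fun x a => (hb x a).1⟩,
    ⟨measurable_from_prod_countable_left fun a => (hc a).measurable, fun x a => ?_⟩⟩
  have : 0 ≤ P.c x a := by
    cases a
    · exact (hc0 x).1
    · exact (hc0 x).1.trans (hc0 x).2.le
  rw [abs_of_nonneg this]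
  exact (hb x a).2

/-- For every price there is a threshold whose two policies are optimal, and the optimal actions
are determined by the position of the index relative to the price. -/
theorem exists_optimal_threshold (hP : P.WeightedNormAssumption) (hPCL : P.PCLIndexable)
    (lam : ℝ) :
    ∃ z : EReal, P.IsOptimal lam (P.zPolicy z) ∧ P.IsOptimal lam (P.zMinusPolicy z) ∧
      P.optSet lam true = {x | lam ≤ P.mpIndex x} ∧
      P.optSet lam false = {x | P.mpIndex x ≤ lam} := by
  obtain ⟨w, M, γ, hM, hw, hr, hc⟩ := hP.exists_contractingWeight
  obtain ⟨h1, ⟨hmono, hcont, -⟩, h3⟩ := hPCL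
  have hg (x : P.State) (z : EReal) : 0 < P.marginal P.c z x := by
    rw [← marginal_eq hc hM hw]
    exact h1 x z
  have hJ : Monotone P.mpIndexExt := hmono.comp P.monotone_clamp
  have hJc : Continuous P.mpIndexExt := hcont.comp P.continuous_clamp
  obtain ⟨z, hact, hpas, hsign⟩ := exists_threshold hr hc hM hw hg hJ hJc h3 lam
  simp only [mpIndexExt_coe] at hact hpas hsign
  have hz := measurable_thresholdRule (P := P) z
  have hvr := wBounded_ruleValue hr hw hz
  have hvc := wBounded_ruleValue hc hw hz
  set v : P.State → ℝ := fun y => P.ruleValue P.r (P.thresholdRule z) y -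
    lam * P.ruleValue P.c (P.thresholdRule z) y with hv
  have hvb : WBounded w _ v := hvr.sub (hvc.const_mul lam)
  have hn := wBoundedCost_netReward hr hc lam
  have hMn : 0 ≤ M + |lam| * M := add_nonneg hM (mul_nonneg (abs_nonneg lam) hM)
  have hadv (p : P.SA) : P.advantage (P.netReward lam) v p =
      P.advantage P.r (P.ruleValue P.r (P.thresholdRule z)) p -
        lam * P.advantage P.c (P.ruleValue P.c (P.thresholdRule z)) p :=
    advantage_netReward hvr hvc hw lam p
  have hself (y : P.State) : P.advantage (P.netReward lam) v (y, P.thresholdRule z y) = 0 := by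
    rw [hadv, advantage_ruleValue hr hw hM hz, advantage_ruleValue hc hw hM hz]
    ring
  have hdiff (y : P.State) : P.advantage (P.netReward lam) v (y, true) -
      P.advantage (P.netReward lam) v (y, false) =
        P.marginal P.r z y - lam * P.marginal P.c z y := by
    rw [hadv, hadv, ← advantage_true_sub_false, ← advantage_true_sub_false]
    ring
  -- In each state the action of the `z`-policy has advantage zero, and `hdiff` with `hsign` makes
  -- the other action no better: this is the Bellman optimality equation for `v`.
  have hnonpos (p : P.SA) : P.advantage (P.netReward lam) v p ≤ 0 := by
    obtain ⟨y, a⟩ := p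
    have hs := hself y
    rcases lt_or_ge z ((y : ℝ) : EReal) with hy | hy
    · rw [thresholdRule_eq_true.2 hy] at hs
      have := (hsign y).1.2 (hact y hy.le)
      cases a <;> linarith [hdiff y]
    · rw [thresholdRule_eq_false.2 hy] at hs
      have := (hsign y).2.2 (hpas y hy)
      cases a <;> linarith [hdiff y]
  have hle (x : P.State) (π : P.Policy) : P.V lam x π ≤ v x := by
    rw [V_eq_total hr hc hM hw]
    exact total_le_of_advantage_nonpos hn hMn hvb hw hnonpos x π
  have hopt {π : P.Policy} (hπ : ∀ x, P.V lam x π = v x) : P.IsOptimal lam π := fun x =>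
    ⟨by rintro _ ⟨π', rfl⟩; rw [hπ]; exact hle x π', fun b hb => hb ⟨π, rfl⟩⟩
  have hzv (x : P.State) : P.V lam x (P.zPolicy z) = v x := by
    rw [V_eq_total hr hc hM hw]
    exact total_regionPolicy_eq hn hMn hvb hw _ (fun _ => thresholdRule_eq_true) hself x
  have hzmv (x : P.State) : P.V lam x (P.zMinusPolicy z) = v x := by
    rw [V_eq_total hr hc hM hw]
    refine total_regionPolicy_eq hn hMn hvb hw _ (a := fun y => decide (z ≤ ((y : ℝ) : EReal)))
      (fun _ => decide_eq_true_iff) (fun y => ?_) x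
    have hs := hself y
    rcases lt_trichotomy z ((y : ℝ) : EReal) with hy | hy | hy
    · rwa [decide_eq_true hy.le, ← thresholdRule_eq_true.2 hy]
    -- The only state in which the two policies differ: there the index equals the price, the net
    -- marginal vanishes, and the active action too has advantage zero.
    · rw [thresholdRule_eq_false.2 hy.ge] at hs
      rw [decide_eq_true hy.le]
      linarith [hdiff y, (hsign y).1.2 (hact y hy.le), (hsign y).2.2 (hpas y hy.ge)]
    · rwa [decide_eq_false hy.not_ge, ← thresholdRule_eq_false.2 hy.le]
  -- The supremum is attained by the `z`-policy, so `P.optSet` can be computed from the advantages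
  -- over `v`.
  have hoptV : P.optV lam = v := by
    funext x
    have : Nonempty P.Policy := ⟨P.zPolicy z⟩
    rw [optV, (hopt hzv x).ciSup_eq, hzv]
  have hbell (a : Bool) (y : P.State) :
      P.bellman lam a v y = P.advantage (P.netReward lam) v (y, a) + v y := by
    simp only [bellman, advantage, netReward]
    ring
  refine ⟨z, hopt hzv, hopt hzmv, ?_, ?_⟩
  · ext y
    rw [optSet, hoptV, mem_ofPred_eq, mem_ofPred_eq, ← (hsign y).1, hbell, hbell, ← hdiff]
    simp
  · ext y
    rw [optSet, hoptV, mem_ofPred_eq, mem_ofPred_eq, ← (hsign y).2, hbell, hbell, ← hdiff]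
    simp

end Project

end RestlessBandit

theorem theorem1 (P : RestlessBandit.Project) (hP : P.WeightedNormAssumption)
    (hPCL : P.PCLIndexable) :
    P.StronglyThresholdIndexable ∧ P.IndexableWith P.mpIndex := by
  have h := fun lam => RestlessBandit.Project.exists_optimal_threshold hP hPCL lam
  have hidx : P.IndexableWith P.mpIndex := fun lam => by
    obtain ⟨z, -, -, h1, h0⟩ := h lam
    exact ⟨h1, h0⟩
  refine ⟨⟨⟨P.mpIndex, hidx⟩, fun lam => ?_⟩, hidx⟩
  obtain ⟨z, hz, hzm, -, -⟩ := h lam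
  exact ⟨z, hz, hzm⟩
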